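/- Let $1\le n\le g$ and $N\ge 0$ be integers. A square-tiled surface in $\mathcal H(2g-2)$ is a connected closed oriented surface glued from finitely many unit squares (top sides to bottom sides, left sides to right sides, by orientation-respecting isometries), together with a distinguished vertex of the tiling at which the total angle is $2\pi(2g-1)$, while the total angle at every other vertex is $2\pi$ (for $g\ge 2$ the distinguished vertex is thus the unique conical singularity; for $g=1$ it is a marked vertex, and it is treated as a conical singularity below). Two such surfaces are identified if there is a bijection between their squares that respects the gluings and the distinguished vertices. For such a surface $S$ let $G_S\subset S$ be the union of the distinguished vertex and of all horizontal saddle connections, i.e. of the horizontal sides that lie on a geodesic joining the distinguished vertex to itself. The cylinders of $S$ are the connected components of $S\setminus G_S$. Let $\mathcal{ST}_n(\mathcal H(2g-2),N)$ be the set of square-tiled surfaces in $\mathcal H(2g-2)$ with exactly $n$ cylinders and at most $N$ squares. A ribbon graph is a connected graph (loops and multiple edges allowed) with a circular ordering of the half-edges at each vertex; its boundary components are those of its tubular neighborhood, and its genus $\gamma$ is given by $V-E+F=2-2\gamma$, where $V,E,F$ are the numbers of vertices, edges and boundary components. For $\gamma\ge 0$ and $k,l\ge 1$ let $\mathcal E_{\gamma,k,l}$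 be the finite set of isomorphism classes of ribbon graphs of genus $\gamma$ with one vertex, $k$ black boundary components labeled $1,\dots,k$ and $l$ white boundary components labeled $1,\dots,l$, such that the two sides of every edge belong to boundary components of opposite colors; isomorphisms respect circular orderings, colors and labels. For $G\in\mathcal E_{\gamma,k,l}$, $L\in\mathbb Z^k$, $L'\in\mathbb Z^l$ let $\mathcal P_G(L,L')$ be the number of assignments of positive integer lengths to the edges of $G$ such that, for all $i$ and $j$, the $i$-th black and the $j$-th white boundary components have perimeters (sums of the lengths of the edges along them) $L_i$ and $L'_j$. Put $$\mathcal P^{\gamma}_{k,l}(L;L')=\sum_{G\in\mathcal E_{\gamma,k,l}}\frac{1}{|\operatorname{Aut}(G)|}\,\mathcal P_G(L,L').$$ Then the set $\mathcal{ST}_n(\mathcal H(2g-2),N)$ is finite and $$|\mathcal{ST}_n(\mathcal H(2g-2),N)|=\frac1{n!}\sum_{\substack{h_1L_1+\dots+h_nL_n\le N\\ h_i,L_i\in\mathbb Z_{>0}}}L_1\cdots L_n\cdot\mathcal P^{\,g-n}_{n,n}(L_1,\dots,L_n;L_1,\dots,L_n).$$ -/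

import Mathlib

/-! ### Square-tiled surfaces -/

/-- A gluing of the unit squares indexed by `Q` into a connected oriented closed surface: the right
side of the square `q` is glued to the left side of `right q`, and the top side of `q` is glued to
the bottom side of `up q`. -/
structure SquareGluing (Q : Type) where
  /-- the square to the right of a given square -/
  right : Equiv.Perm Q
  /-- the square above a given square -/
  up : Equiv.Perm Q
  /-- the glued surface is connected -/
  connected : MulAction.IsPretransitive (Subgroup.closure {right, up}) Q

namespace SquareGluing

variable {Q : Type} (S : SquareGluing Q)

/-- Turning counterclockwise by the angle `2π` around the bottom left corner of a square: one
crosses a left side, a bottom side, a right side and a top side, and arrives in a square which again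
has its bottom left corner at that vertex. -/
def turn : Equiv.Perm Q := S.up * S.right * S.up⁻¹ * S.right⁻¹

/-- The vertices of the tiling. Each vertex is given by the cycle of those squares whose bottom left
corner is at the vertex. -/
def Vertex : Type := Quotient (Equiv.Perm.SameCycle.setoid S.turn)

/-- The vertex at the bottom left corner of the square `q`. -/
def bottomLeft (q : Q) : S.Vertex := Quotient.mk _ q

/-- The multiplicity `m` of a vertex, i.e. the number of bottom left corners of squares at it: the
vertex has `4 * m` incident corners of squares, the total angle around it is `2π * m`, and the
differential has a zero of order `m - 1` there. -/
noncomputable def multiplicity (v : S.Vertex) : ℕ := Nat.card {q : Q // S.bottomLeft q = v}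

end SquareGluing

/-- A square-tiled surface of genus `g` in the minimal stratum `H(2g - 2)`, with squares indexed by
`Q`: the labeled zero of order `2g - 2` is a vertex, and all other vertices are regular points. (For
`g = 1` the labeled zero of order `0` is just a marked vertex.) -/
structure MinimalSurface (g : ℕ) (Q : Type) extends SquareGluing Q where
  /-- the unique conical singularity -/
  zero : toSquareGluing.Vertex
  multiplicity_zero : toSquareGluing.multiplicity zero = (2 * g - 2) + 1
  multiplicity_other : ∀ v, v ≠ zero → toSquareGluing.multiplicity v = 1

namespace MinimalSurface

variable {g : ℕ} {Q Q' : Type}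

/-- Isomorphism of square-tiled surfaces: a bijection between the squares respecting the gluings and
the conical singularities. -/
def Isomorphic (S : MinimalSurface g Q) (T : MinimalSurface g Q') : Prop :=
  ∃ e : Q ≃ Q', (∀ q, e (S.right q) = T.right (e q)) ∧ (∀ q, e (S.up q) = T.up (e q)) ∧
    ∀ q, S.bottomLeft q = S.zero ↔ T.bottomLeft (e q) = T.zero

/-- The bottom side of the square `q` is contained in the graph `G_S` formed by the conical
singularity and the horizontal saddle connections: continuing this side horizontally, along the
bottom sides of the squares `right ^ i q`, one meets the conical singularity. Otherwise the
side is a part of a simple closed horizontal geodesic through regular points only. -/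
def BottomInSaddleGraph (S : MinimalSurface g Q) (q : Q) : Prop :=
  ∃ p, S.right.SameCycle q p ∧ S.bottomLeft p = S.zero

/-- Two squares which are adjacent across a side that is not contained in the graph `G_S`. (Vertical
sides are never contained in it; the top side of `p` is the bottom side of `up p`.) -/
def Adjacent (S : MinimalSurface g Q) (p q : Q) : Prop :=
  q = S.right p ∨ (q = S.up p ∧ ¬ S.BottomInSaddleGraph q)

/-- The cylinders: the connected components of the complement of `G_S` in the surface, each given
by the set of the squares that form it. -/
def Cylinder (S : MinimalSurface g Q) : Type := Quotient (Relation.EqvGen.setoid S.Adjacent)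

/-- The number of cylinders. -/
noncomputable def numCylinders (S : MinimalSurface g Q) : ℕ := Nat.card S.Cylinder

theorem Isomorphic.refl (S : MinimalSurface g Q) : S.Isomorphic S :=
  ⟨Equiv.refl Q, fun _ => rfl, fun _ => rfl, fun _ => Iff.rfl⟩

theorem Isomorphic.symm {S : MinimalSurface g Q} {T : MinimalSurface g Q'}
    (h : S.Isomorphic T) : T.Isomorphic S := by
  obtain ⟨e, h1, h2, h3⟩ := h
  refine ⟨e.symm, fun q => ?_, fun q => ?_, fun q => ?_⟩
  · rw [Equiv.symm_apply_eq, h1, Equiv.apply_symm_apply]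
  · rw [Equiv.symm_apply_eq, h2, Equiv.apply_symm_apply]
  · rw [h3, Equiv.apply_symm_apply]

theorem Isomorphic.trans {Q'' : Type} {S : MinimalSurface g Q} {T : MinimalSurface g Q'}
    {U : MinimalSurface g Q''} (h : S.Isomorphic T) (k : T.Isomorphic U) : S.Isomorphic U := by
  obtain ⟨e, h1, h2, h3⟩ := h
  obtain ⟨f, k1, k2, k3⟩ := k
  exact ⟨e.trans f, fun q => by simp [h1, k1], fun q => by simp [h2, k2],
    fun q => by rw [h3, k3]; rfl⟩

end MinimalSurface

/-- Isomorphism of square-tiled surfaces of genus `g` in `H(2g - 2)` with `n` cylinders and at most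
`N` squares. -/
def surfaceSetoid (g n N : ℕ) :
    Setoid {S : Σ d : ℕ, MinimalSurface g (Fin d) // S.1 ≤ N ∧ S.2.numCylinders = n} where
  r S T := S.1.2.Isomorphic T.1.2
  iseqv := ⟨fun S => .refl S.1.2, fun h => h.symm, fun h k => h.trans k⟩

/-- The set `ST_n(H(2g - 2), N)` of square-tiled surfaces in `H(2g - 2)` with `n` cylinders and at
most `N` squares. -/
def SquareTiledSurfaces (g n N : ℕ) : Type := Quotient (surfaceSetoid g n N)

/-! ### Metric ribbon graphs -/

/-- A ribbon graph (with at least one edge) with set of half-edges `H`, given by the circular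
orderings of the half-edges around the vertices and the pairing of half-edges into edges. Loops and
multiple edges are allowed. -/
structure RibbonGraph (H : Type) where
  /-- the next half-edge in the circular ordering around the vertex -/
  next : Equiv.Perm H
  /-- the other half of the edge -/
  flip : Equiv.Perm H
  flip_flip : ∀ h, flip (flip h) = h
  flip_ne : ∀ h, flip h ≠ h
  nonempty : Nonempty H
  connected : MulAction.IsPretransitive (Subgroup.closure {next, flip}) H

namespace RibbonGraph

variable {H : Type} (G : RibbonGraph H)

/-- The vertices: cycles of half-edges around vertices. -/
def Vertex : Type := Quotient (Equiv.Perm.SameCycle.setoid G.next)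

/-- The edges: pairs of half-edges. -/
def Edge : Type := Quotient (Equiv.Perm.SameCycle.setoid G.flip)

/-- The boundary components of the tubular neighborhood. A half-edge `h` stands for one of the two
sides of its edge (`flip h` stands for the other side): follow this side away from the vertex of
`h` to the other end of the edge, and pass to the side of the next edge there. -/
def Boundary : Type := Quotient (Equiv.Perm.SameCycle.setoid (G.next * G.flip))

/-- The edge of a half-edge. -/
def edge (h : H) : G.Edge := Quotient.mk _ h

/-- The boundary component along the side `h`. -/
def boundary (h : H) : G.Boundary := Quotient.mk _ h

/-- Euler's formula `V - E + F = 2 - 2g`, which determines the genus `g`. -/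
def HasGenus (g : ℕ) : Prop :=
  (Nat.card G.Vertex : ℤ) - Nat.card G.Edge + Nat.card G.Boundary = 2 - 2 * g

/-- The perimeter of a boundary component, for an assignment of lengths to the edges: the sum of
the lengths of the edges along the boundary component (with multiplicity). -/
noncomputable def perimeter [Fintype H] (ℓ : G.Edge → ℤ) (b : G.Boundary) : ℤ :=
  open Classical in ∑ h : H with G.boundary h = b, ℓ (G.edge h)

end RibbonGraph

/-- A genus `g` ribbon graph with one vertex, `k` labeled black and `l` labeled white boundary
components (black labels are `Sum.inl i`, white labels are `Sum.inr j`), such that the two sides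
of every edge belong to boundary components of opposite colors. -/
structure ColoredRibbonGraph (g k l : ℕ) (H : Type) extends RibbonGraph H where
  one_vertex : Nat.card toRibbonGraph.Vertex = 1
  label : toRibbonGraph.Boundary ≃ Fin k ⊕ Fin l
  genus : toRibbonGraph.HasGenus g
  opposite : ∀ h, (label (toRibbonGraph.boundary h)).isLeft ≠
    (label (toRibbonGraph.boundary (toRibbonGraph.flip h))).isLeft

namespace ColoredRibbonGraph

variable {g k l : ℕ} {H H' : Type}

/-- A bijection between half-edges is an isomorphism if it respects the circular orderings, the
edges, and the colors and labels of the boundary components. -/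
def IsIso (G : ColoredRibbonGraph g k l H) (G' : ColoredRibbonGraph g k l H') (e : H ≃ H') :
    Prop :=
  (∀ h, e (G.next h) = G'.next (e h)) ∧ (∀ h, e (G.flip h) = G'.flip (e h)) ∧
    ∀ h, G'.label (G'.boundary (e h)) = G.label (G.boundary h)

/-- The automorphisms of a ribbon graph. -/
def Aut (G : ColoredRibbonGraph g k l H) : Type := {e : H ≃ H // G.IsIso G e}

/-- The number of integral metrics on `G` (positive integer lengths of all edges) for which the
black and white boundary components have the perimeters `L` and `L'`. -/
noncomputable def metricCount [Fintype H] (G : ColoredRibbonGraph g k l H)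
    (L : Fin k → ℤ) (L' : Fin l → ℤ) : ℕ :=
  Nat.card {ℓ : G.Edge → ℤ // (∀ e, 0 < ℓ e) ∧
    (∀ i, G.perimeter ℓ (G.label.symm (Sum.inl i)) = L i) ∧
    (∀ j, G.perimeter ℓ (G.label.symm (Sum.inr j)) = L' j)}

end ColoredRibbonGraph

/-- Isomorphism of colored ribbon graphs. -/
def ribbonSetoid (g k l : ℕ) : Setoid (Σ m : ℕ, ColoredRibbonGraph g k l (Fin m)) where
  r G G' := ∃ e, G.2.IsIso G'.2 e
  iseqv := by
    refine ⟨fun G => ⟨Equiv.refl _, fun _ => rfl, fun _ => rfl, fun _ => rfl⟩, ?_, ?_⟩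
    · rintro G G' ⟨e, h1, h2, h3⟩
      refine ⟨e.symm, fun q => ?_, fun q => ?_, fun q => ?_⟩
      · rw [Equiv.symm_apply_eq, h1, Equiv.apply_symm_apply]
      · rw [Equiv.symm_apply_eq, h2, Equiv.apply_symm_apply]
      · rw [← h3, Equiv.apply_symm_apply]
    · rintro G G' G'' ⟨e, h1, h2, h3⟩ ⟨f, k1, k2, k3⟩
      exact ⟨e.trans f, fun q => by simp [h1, k1], fun q => by simp [h2, k2],
        fun q => by rw [← h3, ← k3]; rfl⟩

/-- The (finite) set `E_{g,k,l}` of isomorphism classes of genus `g` ribbon graphs with one vertex,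
`k` labeled black and `l` labeled white boundary components. -/
def RibbonClasses (g k l : ℕ) : Type := Quotient (ribbonSetoid g k l)

/-- The weighted counting function `P^g_{k,l}(L, L')`: the sum over the isomorphism classes in
`E_{g,k,l}` of the number of integral metrics with perimeters `L` and `L'`, divided by the number
of automorphisms. (Both numbers depend only on the isomorphism class.) -/
noncomputable def weightedCount (g k l : ℕ) (L : Fin k → ℤ) (L' : Fin l → ℤ) : ℚ :=
  ∑ᶠ c : RibbonClasses g k l,
    1 / (Nat.card (Quotient.out c).2.Aut : ℚ) * ((Quotient.out c).2.metricCount L L' : ℚ)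

/-! ### The range of summation -/

/-- The pairs `(h, L)` of tuples of `n` positive integers with `h_1 L_1 + ... + h_n L_n ≤ N`. (Then
all `h_i` and `L_i` are at most `N`.) -/
def heightsCircumferences (n N : ℕ) : Finset ((Fin n → ℕ) × (Fin n → ℕ)) :=
  ((Fintype.piFinset fun _ => Finset.Icc 1 N) ×ˢ (Fintype.piFinset fun _ => Finset.Icc 1 N)).filter
    fun p => ∑ i, p.1 i * p.2 i ≤ N

theorem mem_heightsCircumferences {n N : ℕ} {p : (Fin n → ℕ) × (Fin n → ℕ)} :
    p ∈ heightsCircumferences n N ↔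
      (∀ i, 0 < p.1 i) ∧ (∀ i, 0 < p.2 i) ∧ ∑ i, p.1 i * p.2 i ≤ N := by
  simp only [heightsCircumferences, Finset.mem_filter, Finset.mem_product, Fintype.mem_piFinset,
    Finset.mem_Icc]
  constructor
  · rintro ⟨⟨h1, h2⟩, h3⟩
    exact ⟨fun i => (h1 i).1, fun i => (h2 i).1, h3⟩
  · rintro ⟨h1, h2, h3⟩
    have key : ∀ i, p.1 i * p.2 i ≤ N := fun i =>
      (Finset.single_le_sum (f := fun i => p.1 i * p.2 i) (fun _ _ => Nat.zero_le _)
        (Finset.mem_univ i)).trans h3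
    exact ⟨⟨fun i => ⟨h1 i, (Nat.le_mul_of_pos_right _ (h2 i)).trans (key i)⟩,
      fun i => ⟨h2 i, (Nat.le_mul_of_pos_left _ (h1 i)).trans (key i)⟩⟩, h3⟩

/-! The proof counts rooted objects, so that automorphisms disappear on both sides. A surface is
rooted at one of the `2 * g - 1` squares whose bottom left corner is the distinguished vertex; a
ribbon graph is rooted at a black side of an edge. Euler's formula with one vertex, `2n` boundary
components and genus `g - n` also gives `2 * g - 1` edges, so one set `C` with a fixed cyclic
permutation `W` indexes the saddle connections of the surface and the edges of the graph.

Cutting a rooted surface along its horizontal saddle connections yields a `CylinderDatum`: the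
cycles of `perm` are the lower boundaries of cylinders, those of `W * perm` the upper ones, since
the two successors of a saddle connection differ by a turn of `2π`. This correspondence is bijective
(`CylinderDatum.exists_isIso`, `CylinderDatum.eq_of_isIso`). Surfaces in a minimal stratum have no
nontrivial automorphisms (`MinimalSurface.eq_refl_of_isIso`, by a transfer argument), so each
isomorphism class has exactly `|C|` rootings. Labeling the cylinders multiplies the count by `n!`.

A rooted ribbon graph is a `LabeledPerm`, i.e. `perm` with labeled cycles of `perm` and `W * perm`.
A graph `G` has `|C| / |Aut G|` rootings up to isomorphism (`LabeledPerm.card_isIso_mul_card_aut`),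
which absorbs the weights in `weightedCount` (`LabeledPerm.card_mul_weightedCount`).

A rooted surface with labeled cylinders amounts to heights and circumferences, a `LabeledPerm`, an
integral metric with equal black and white perimeters, and a gluing of the cylinders. The gluings
are the bijections conjugating two permutations with labeled cycles of lengths `L i`, so there are
`∏ i, L i` of them: one twist per cylinder (`LabeledPerm.card_gluing`). Hence `|C| * n! * |ST_n|`
equals `|C|` times the sum in the theorem, and `|C|` cancels. -/

open Equiv

/-! ### Labels of the cycles of a permutation -/

/-- The fibres of `a` are exactly the cycles of `f`. -/
def IsCycleLabel {X ι : Type} (f : Perm X) (a : X → ι) : Prop :=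
  Function.Surjective a ∧ ∀ x y, a x = a y ↔ f.SameCycle x y

namespace IsCycleLabel

variable {X Y ι : Type} {f : Perm X} {g : Perm Y} {a : X → ι} {b : Y → ι}

theorem apply_eq (ha : IsCycleLabel f a) (x : X) : a (f x) = a x :=
  (ha.2 _ _).2 (Perm.sameCycle_apply_left.2 (Perm.SameCycle.refl _ _))

theorem zpow_apply_eq (ha : IsCycleLabel f a) (z : ℤ) (x : X) : a ((f ^ z) x) = a x :=
  (ha.2 _ _).2 (Perm.sameCycle_zpow_left.2 (Perm.SameCycle.refl _ _))

theorem inv (ha : IsCycleLabel f a) : IsCycleLabel f⁻¹ a :=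
  ⟨ha.1, fun x y => by rw [ha.2, Perm.sameCycle_inv]⟩

theorem of_forall_sameCycle (x₀ : X) (h : ∀ x, f.SameCycle x₀ x) :
    IsCycleLabel f (fun _ : X => ()) :=
  ⟨fun _ => ⟨x₀, rfl⟩, fun x y => ⟨fun _ => (h x).symm.trans (h y), fun _ => rfl⟩⟩

/-- Whether two powers agree at a point depends only on the length of its cycle. This makes the map
in `exists_conj` well defined and injective. -/
theorem zpow_apply_eq_zpow_apply [Finite X] (ha : IsCycleLabel f a) (x : X) (m z : ℤ) :
    (f ^ m) x = (f ^ z) x ↔ m ≡ z [ZMOD (Nat.card {y // a y = a x} : ℕ)] := by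
  classical
  have := Fintype.ofFinite X
  have hs : f.IsCycleOn ((Finset.univ.filter fun y => a y = a x : Finset X) : Set X) := by
    refine ⟨⟨fun y hy => ?_, f.injective.injOn, fun y hy => ⟨f⁻¹ y, ?_, by simp⟩⟩, ?_⟩
    · simpa [ha.apply_eq] using hy
    · have := ha.inv.apply_eq y
      simp_all
    · intro y hy z hz
      simp only [Finset.coe_filter, Finset.mem_univ, true_and, Set.mem_ofPred_eq] at hy hz
      exact (ha.2 _ _).1 (hy.trans hz.symm)
  rw [hs.zpow_apply_eq_zpow_apply (by simp), Nat.card_eq_fintype_card, Fintype.card_subtype]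

theorem intertwine_zpow {e : X → Y} (he : ∀ x, e (f x) = g (e x)) (z : ℤ) (x : X) :
    e ((f ^ z) x) = (g ^ z) (e x) := by
  have hinv : ∀ x, e (f⁻¹ x) = g⁻¹ (e x) := fun x => by
    rw [Perm.eq_inv_iff_eq, ← he, Perm.inv_def, apply_symm_apply]
  induction z with
  | zero => rfl
  | succ n ih => rw [add_comm, zpow_add, zpow_add, Perm.mul_apply, Perm.mul_apply, zpow_one,
      zpow_one, he, ih]
  | pred n ih => rw [sub_eq_neg_add, zpow_add, zpow_add, Perm.mul_apply, Perm.mul_apply,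
      zpow_neg_one, zpow_neg_one, hinv, ih]

/-- Two permutations with cycles of the same lengths are conjugate, by a bijection with prescribed
values at one point of each cycle. -/
theorem exists_conj [Finite X] [Finite Y] (ha : IsCycleLabel f a) (hb : IsCycleLabel g b)
    (hcard : ∀ i, Nat.card {x // a x = i} = Nat.card {y // b y = i})
    {x₀ : ι → X} {y₀ : ι → Y} (hx₀ : ∀ i, a (x₀ i) = i) (hy₀ : ∀ i, b (y₀ i) = i) :
    ∃ e : X ≃ Y, (∀ x, e (f x) = g (e x)) ∧ (∀ x, b (e x) = a x) ∧ ∀ i, e (x₀ i) = y₀ i := by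
  -- Each point is reached from the marked point of its cycle; the exponent is not unique, but `key`
  -- shows that its choice is immaterial.
  have hk : ∀ x, ∃ z : ℤ, (f ^ z) (x₀ (a x)) = x := fun x => (ha.2 _ _).1 (hx₀ (a x))
  choose k hk using hk
  have key : ∀ (i : ι) (m z : ℤ), (f ^ m) (x₀ i) = (f ^ z) (x₀ i) ↔ (g ^ m) (y₀ i) = (g ^ z) (y₀ i) := by
    intro i m z
    rw [ha.zpow_apply_eq_zpow_apply, hb.zpow_apply_eq_zpow_apply, hx₀, hy₀, hcard]
  let e : X → Y := fun x => (g ^ k x) (y₀ (a x))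
  have he : ∀ (z : ℤ) i, e ((f ^ z) (x₀ i)) = (g ^ z) (y₀ i) := by
    intro z i
    have h1 : a ((f ^ z) (x₀ i)) = i := by rw [ha.zpow_apply_eq, hx₀]
    have h2 := hk ((f ^ z) (x₀ i))
    simp only [e]
    rw [h1] at h2 ⊢
    exact (key _ _ _).1 h2
  have hinj : Function.Injective e := by
    intro x y hxy
    have hb' : ∀ x, b (e x) = a x := fun x => by simp only [e]; rw [hb.zpow_apply_eq, hy₀]
    have hab : a x = a y := by rw [← hb', ← hb', hxy]
    rw [← hk x, ← hk y, hab, key]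
    simpa only [e, hab] using hxy
  have hsurj : Function.Surjective e := by
    intro y
    obtain ⟨z, hz⟩ := (hb.2 (y₀ (b y)) y).1 (hy₀ _)
    exact ⟨(f ^ z) (x₀ (b y)), by rw [he, hz]⟩
  have hbij : Function.Bijective e := ⟨hinj, hsurj⟩
  refine ⟨Equiv.ofBijective e hbij, fun x => ?_, fun x => ?_, fun i => ?_⟩
  · rw [coe_ofBijective]
    conv_lhs => rw [← hk x]
    conv_rhs => rw [← hk x]
    rw [he, ← Perm.mul_apply, ← zpow_one_add, he, zpow_one_add, Perm.mul_apply]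
  · rw [coe_ofBijective]
    simp only [e]
    rw [hb.zpow_apply_eq, hy₀]
  · rw [coe_ofBijective]
    exact he 0 i

/-- An intertwining bijection is determined on a cycle by its value at one point; this is why
`card_conj` is a product of cycle lengths. -/
theorem conj_ext (ha : IsCycleLabel f a) {x₀ : ι → X} (hx₀ : ∀ i, a (x₀ i) = i) {e e' : X ≃ Y}
    (he : ∀ x, e (f x) = g (e x)) (he' : ∀ x, e' (f x) = g (e' x))
    (h : ∀ i, e (x₀ i) = e' (x₀ i)) : e = e' := by
  ext x
  obtain ⟨z, hz⟩ := (ha.2 _ _).1 (hx₀ (a x))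
  rw [← hz, intertwine_zpow he, intertwine_zpow he', h]

/-- The number of bijections that conjugate two permutations and respect the labels of cycles. -/
theorem card_conj [Finite X] [Finite Y] [Fintype ι] (ha : IsCycleLabel f a)
    (hb : IsCycleLabel g b) (hcard : ∀ i, Nat.card {x // a x = i} = Nat.card {y // b y = i}) :
    Nat.card {e : X ≃ Y // (∀ x, e (f x) = g (e x)) ∧ ∀ x, b (e x) = a x} =
      ∏ i, Nat.card {y // b y = i} := by
  choose x₀ hx₀ using ha.1
  rw [← Nat.card_pi]
  refine Nat.card_congr (Equiv.ofBijective (fun e i => ⟨e.1 (x₀ i), by rw [e.2.2, hx₀]⟩) ⟨?_, ?_⟩)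
  · intro e e' h
    refine Subtype.ext (ha.conj_ext hx₀ e.2.1 e'.2.1 fun i => ?_)
    simpa using congr_fun h i
  · intro y
    obtain ⟨e, h1, h2, h3⟩ := ha.exists_conj hb hcard hx₀ fun i => (y i).2
    exact ⟨⟨e, h1, h2⟩, funext fun i => Subtype.ext (h3 i)⟩

/-- The labels of cycles are the bijections from the set of cycles. -/
noncomputable def equivQuotient (f : Perm X) (ι : Type) :
    {a : X → ι // IsCycleLabel f a} ≃ (Quotient (Perm.SameCycle.setoid f) ≃ ι) where
  toFun a := Equiv.ofBijective (Quotient.lift a.1 fun x y h => (a.2.2 x y).2 h)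
    ⟨by
      rintro ⟨x⟩ ⟨y⟩ h
      exact Quotient.sound ((a.2.2 x y).1 h), fun i => by
      obtain ⟨x, hx⟩ := a.2.1 i
      exact ⟨Quotient.mk _ x, hx⟩⟩
  invFun e := ⟨fun x => e (Quotient.mk _ x), e.surjective.comp Quotient.mk_surjective,
    fun x y => by rw [e.injective.eq_iff]; exact Quotient.eq⟩
  left_inv a := rfl
  right_inv e := by ext ⟨x⟩; rfl

end IsCycleLabel

/-! ### Connectedness -/

/-- On a finite set the inverse image of a point is also reached by a nonnegative power. -/
theorem Equiv.Perm.inv_apply_of_forall {X : Type} [Finite X] {f : Perm X} {P : X → Prop}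
    (h : ∀ x, P x → P (f x)) {x : X} (hx : P x) : P (f⁻¹ x) := by
  have h1 : ∀ n : ℕ, P ((f ^ n) x) := fun n => by
    induction n with
    | zero => exact hx
    | succ n ih => rw [pow_succ', Perm.mul_apply]; exact h _ ih
  obtain ⟨n, hn⟩ := (Perm.sameCycle_symm_apply_right.2 (Perm.SameCycle.refl f x)).exists_nat_pow_eq
  rw [Perm.inv_def, ← hn]
  exact h1 n

/-- This form of connectedness is the one used throughout: by finiteness it is enough to propagate a
property forward along the two generators. -/
theorem isPretransitive_closure_pair_iff {X : Type} [Finite X] (f g : Perm X) :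
    MulAction.IsPretransitive (Subgroup.closure {f, g}) X ↔
      ∀ P : X → Prop, (∀ x, P x → P (f x)) → (∀ x, P x → P (g x)) → ∀ x y, P x → P y := by
  constructor
  · intro h P hf hg x y hx
    obtain ⟨⟨k, hk⟩, rfl⟩ := MulAction.exists_smul_eq (Subgroup.closure {f, g}) x y
    change P (k x)
    induction hk using Subgroup.closure_induction generalizing x with
    | mem k hk =>
      rcases hk with rfl | rfl
      exacts [hf x hx, hg x hx]
    | one => exact hx
    | mul k l _ _ ihk ihl => exact ihk _ (ihl _ hx)
    | inv k _ ih => exact Equiv.Perm.inv_apply_of_forall ih hx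
  · intro h
    refine ⟨fun x y => ?_⟩
    refine h (fun y => ∃ k : Subgroup.closure {f, g}, k • x = y) ?_ ?_ x y ⟨1, one_smul _ _⟩
    · rintro _ ⟨k, rfl⟩
      exact ⟨⟨f, Subgroup.subset_closure (by simp)⟩ * k, mul_smul _ _ _⟩
    · rintro _ ⟨k, rfl⟩
      exact ⟨⟨g, Subgroup.subset_closure (by simp)⟩ * k, mul_smul _ _ _⟩

/-! ### Towers -/

/-- The discrete region under the graph of `τ`. -/
@[ext]
structure Tower {X : Type} (τ : X → ℕ+) : Type where
  /-- the point of the base -/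
  pt : X
  /-- the level -/
  lvl : ℕ
  lt : lvl < τ pt

namespace Tower

variable {X Y : Type} {τ τ' : X → ℕ+}

/-- The point at level `0`. -/
def base (τ : X → ℕ+) (x : X) : Tower τ := ⟨x, 0, (τ x).pos⟩

/-- The top level. -/
def top (τ : X → ℕ+) (x : X) : Tower τ := ⟨x, τ x - 1, Nat.sub_lt (τ x).pos one_pos⟩

@[simp] theorem base_pt (x : X) : (base τ x).pt = x := rfl

@[simp] theorem base_lvl (x : X) : (base τ x).lvl = 0 := rfl

theorem base_injective : Function.Injective (base τ) := fun _ _ h => congr_arg pt h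

theorem eq_base {p : Tower τ} (h : p.lvl = 0) : p = base τ p.pt := by
  ext <;> simp [h]

theorem eq_top {p : Tower τ} (h : ¬ p.lvl + 1 < τ p.pt) : p = top τ p.pt := by
  have := p.lt
  ext
  · rfl
  · simp only [top]; omega

/-- The fibres of the projection to the base. -/
def equivSigma (τ : X → ℕ+) : Tower τ ≃ Σ x, Fin (τ x) where
  toFun p := ⟨p.pt, p.lvl, p.lt⟩
  invFun p := ⟨p.1, p.2.1, p.2.2⟩
  left_inv _ := rfl
  right_inv _ := rfl

instance [Finite X] : Finite (Tower τ) := Finite.of_equiv _ (equivSigma τ).symm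

theorem card_eq [Fintype X] (τ : X → ℕ+) : Nat.card (Tower τ) = ∑ x, (τ x : ℕ) := by
  rw [Nat.card_congr (equivSigma τ), Nat.card_sigma]
  simp

/-- Going up in the tower over `X`; from the top level one returns to the base by `ρ`. -/
def shift (τ : X → ℕ+) (ρ : Perm X) : Perm (Tower τ) where
  toFun p := if h : p.lvl + 1 < τ p.pt then ⟨p.pt, p.lvl + 1, h⟩ else base τ (ρ p.pt)
  invFun p := if p.lvl = 0 then top τ (ρ.symm p.pt) else ⟨p.pt, p.lvl - 1, by have := p.lt; omega⟩
  left_inv p := by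
    by_cases h : p.lvl + 1 < τ p.pt
    · simp [h]
    · simp only [h, dite_false, base_lvl, if_true, base_pt, symm_apply_apply]
      exact (eq_top h).symm
  right_inv p := by
    by_cases h : p.lvl = 0
    · have : (top τ (ρ.symm p.pt)).lvl + 1 = τ (ρ.symm p.pt) := Nat.sub_add_cancel (τ _).pos
      have h2 : ¬ (top τ (ρ.symm p.pt)).lvl + 1 < τ (top τ (ρ.symm p.pt)).pt := by
        rw [this]; exact lt_irrefl _
      simp only [h, if_true, h2, dite_false]
      rw [eq_base h]
      simp [top]
    · have h1 : p.lvl - 1 + 1 = p.lvl := Nat.sub_add_cancel (Nat.pos_of_ne_zero h)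
      have := p.lt
      simp [h, h1, this]

theorem shift_of_lt (ρ : Perm X) {p : Tower τ} (h : p.lvl + 1 < τ p.pt) :
    shift τ ρ p = ⟨p.pt, p.lvl + 1, h⟩ := dif_pos h

theorem shift_of_not_lt (ρ : Perm X) {p : Tower τ} (h : ¬ p.lvl + 1 < τ p.pt) :
    shift τ ρ p = base τ (ρ p.pt) := dif_neg h

theorem shift_top (ρ : Perm X) (x : X) : shift τ ρ (top τ x) = base τ (ρ x) := by
  have := (τ x).pos
  exact shift_of_not_lt ρ (by simp only [top]; omega)

/-- A property of towers that propagates upwards. -/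
theorem induction_up {P : Tower τ → Prop} (h0 : ∀ x, P (base τ x))
    (h1 : ∀ x (s : ℕ) (h : s + 1 < τ x), P ⟨x, s, Nat.lt_of_succ_lt h⟩ → P ⟨x, s + 1, h⟩) (p : Tower τ) :
    P p := by
  obtain ⟨x, s, h⟩ := p
  induction s with
  | zero => exact h0 x
  | succ s ih => exact h1 x s h (ih _)

theorem shift_pow_base (ρ : Perm X) (p : Tower τ) : (shift τ ρ ^ p.lvl) (base τ p.pt) = p := by
  induction p using induction_up with
  | h0 x => rfl
  | h1 x s h ih =>
    simp only at ih ⊢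
    rw [pow_succ', Perm.mul_apply, ih]
    exact shift_of_lt ρ h

/-- The cycles of `shift τ ρ` correspond to the cycles of `ρ`. -/
theorem sameCycle_shift_iff (ρ : Perm X) (p q : Tower τ) :
    (shift τ ρ).SameCycle p q ↔ ρ.SameCycle p.pt q.pt := by
  have h1 : ∀ p : Tower τ, (shift τ ρ).SameCycle (base τ p.pt) p := fun p =>
    ⟨p.lvl, by rw [zpow_natCast]; exact shift_pow_base ρ p⟩
  have h2 : ∀ x, (shift τ ρ).SameCycle (base τ x) (base τ (ρ x)) := fun x => by
    refine (h1 (top τ x)).trans ?_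
    rw [← shift_top]
    exact Perm.sameCycle_apply_right.2 (Perm.SameCycle.refl _ _)
  have h3 : ∀ p : Tower τ, ρ.SameCycle p.pt (shift τ ρ p).pt := fun p => by
    by_cases h : p.lvl + 1 < τ p.pt
    · rw [shift_of_lt ρ h]
    · rw [shift_of_not_lt ρ h]
      exact Perm.sameCycle_apply_right.2 (Perm.SameCycle.refl _ _)
  constructor
  · rintro ⟨z, rfl⟩
    induction z with
    | zero => exact Perm.SameCycle.refl _ _
    | succ n ih =>
      rw [add_comm, zpow_add, zpow_one, Perm.mul_apply]
      exact ih.trans (h3 _)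
    | pred n ih =>
      rw [sub_eq_neg_add, zpow_add, zpow_neg_one, Perm.mul_apply]
      refine ih.trans (Perm.SameCycle.symm ?_)
      simpa using h3 ((shift τ ρ)⁻¹ ((shift τ ρ ^ (-(n : ℤ))) p))
  · rintro ⟨z, hz⟩
    refine (h1 p).symm.trans (Perm.SameCycle.trans ?_ (h1 q))
    rw [← hz]
    clear hz
    induction z with
    | zero => exact Perm.SameCycle.refl _ _
    | succ n ih =>
      rw [add_comm, zpow_add, zpow_one, Perm.mul_apply]
      exact ih.trans (h2 _)
    | pred n ih =>
      rw [sub_eq_neg_add, zpow_add, zpow_neg_one, Perm.mul_apply]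
      refine ih.trans (Perm.SameCycle.symm ?_)
      simpa using h2 (ρ.symm ((ρ ^ (-(n : ℤ))) p.pt))

theorem isCycleLabel_shift {ι : Type} {ρ : Perm X} {a : X → ι} (ha : IsCycleLabel ρ a) :
    IsCycleLabel (shift τ ρ) fun p => a p.pt :=
  ⟨fun i => (ha.1 i).imp' (base τ) fun _ h => h, fun p q => by
    rw [ha.2, sameCycle_shift_iff]⟩

/-- A permutation that preserves the heights acts on the tower levelwise. -/
def lift (τ : X → ℕ+) (f : Perm X) (h : ∀ x, τ (f x) = τ x) : Perm (Tower τ) where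
  toFun p := ⟨f p.pt, p.lvl, by rw [h]; exact p.lt⟩
  invFun p := ⟨f.symm p.pt, p.lvl, by rw [← h, apply_symm_apply]; exact p.lt⟩
  left_inv p := by ext <;> simp
  right_inv p := by ext <;> simp

/-- The decomposition into a tower over a given base is unique. -/
theorem le_and_eq {π : Perm Y} {ρ ρ' : Perm X} {e : Tower τ → Y} {e' : Tower τ' → Y}
    (he' : Function.Injective e) (h : ∀ p, e (shift τ ρ p) = π (e p))
    (h' : ∀ p, e' (shift τ' ρ' p) = π (e' p)) (hb : ∀ x, e (base τ x) = e' (base τ' x))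
    (p : Tower τ) : ∃ hp : p.lvl < τ' p.pt, e p = e' ⟨p.pt, p.lvl, hp⟩ := by
  induction p using induction_up with
  | h0 x => exact ⟨(τ' x).pos, hb x⟩
  | h1 x s hs ih =>
    obtain ⟨h1, h2⟩ := ih
    have h3 : e ⟨x, s + 1, hs⟩ = e' (shift τ' ρ' ⟨x, s, h1⟩) := by
      rw [h', ← h2, ← h, shift_of_lt ρ (p := ⟨x, s, Nat.lt_of_succ_lt hs⟩) hs]
    by_cases h4 : s + 1 < τ' x
    · exact ⟨h4, by rw [h3, shift_of_lt]⟩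
    · rw [shift_of_not_lt _ (by exact h4), ← hb] at h3
      exact absurd (congr_arg lvl (he' h3)) (by simp)

/-- Heights are first return times and `ρ` is the first return map, so both are forced by the images
of the base points. `le_and_eq`, applied at the top levels in both directions, gives equality of the
heights. -/
theorem unique {π : Perm Y} {ρ ρ' : Perm X} {e : Tower τ → Y} {e' : Tower τ' → Y}
    (he : Function.Injective e) (he' : Function.Injective e') (h : ∀ p, e (shift τ ρ p) = π (e p))
    (h' : ∀ p, e' (shift τ' ρ' p) = π (e' p)) (hb : ∀ x, e (base τ x) = e' (base τ' x)) :
    τ = τ' ∧ ρ = ρ' ∧ ∀ (p : Tower τ) (hp : p.lvl < τ' p.pt), e p = e' ⟨p.pt, p.lvl, hp⟩ := by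
  have key : τ = τ' := by
    funext x
    refine PNat.coe_injective (le_antisymm ?_ ?_)
    · obtain ⟨h1, -⟩ := le_and_eq he h h' hb (top τ x)
      simp only [top] at h1
      have := (τ x).pos
      omega
    · obtain ⟨h1, -⟩ := le_and_eq he' h' h (fun x => (hb x).symm) (top τ' x)
      simp only [top] at h1
      have := (τ' x).pos
      omega
  subst key
  have key2 := fun p => (le_and_eq he h h' hb p).2
  refine ⟨rfl, ?_, fun p _ => key2 p⟩
  ext x
  apply base_injective (τ := τ)
  apply he'
  rw [← hb, ← shift_top, h, ← shift_top, h']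
  exact congr_arg π (key2 (top τ x))

/-- The decomposition into a tower given by the first return map to the image of `κ`. -/
theorem exists_equiv [Finite X] [Finite Y] (π : Perm Y) {κ : X → Y} (hκ : Function.Injective κ)
    (hmeet : ∀ y, ∃ x, π.SameCycle (κ x) y) :
    ∃ (τ : X → ℕ+) (ρ : Perm X) (e : Tower τ ≃ Y),
      (∀ x, e (base τ x) = κ x) ∧ ∀ p, e (shift τ ρ p) = π (e p) := by
  classical
  -- The height over `x` will be the first return time to the range of `κ`; the order of `π` shows
  -- that a return occurs.
  have hret : ∀ x, ∃ s : ℕ, 0 < s ∧ (π ^ s) (κ x) ∈ Set.range κ := fun x => by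
    refine ⟨orderOf π, orderOf_pos π, x, ?_⟩
    rw [pow_orderOf_eq_one]; rfl
  let τ : X → ℕ+ := fun x => ⟨Nat.find (hret x), (Nat.find_spec (hret x)).1⟩
  have hτ : ∀ x, (π ^ (τ x : ℕ)) (κ x) ∈ Set.range κ := fun x => (Nat.find_spec (hret x)).2
  have hmin : ∀ x (s : ℕ), 0 < s → s < τ x → (π ^ s) (κ x) ∉ Set.range κ := fun x s h0 h1 h2 =>
    Nat.find_min (hret x) h1 ⟨h0, h2⟩
  choose ρ hρ using hτ
  have hcancel : ∀ s s' x x', s ≤ s' → (π ^ s) (κ x) = (π ^ s') (κ x') →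
      κ x = (π ^ (s' - s)) (κ x') := fun s s' x x' h1 h2 => by
    apply (π ^ s).injective
    rw [h2, ← Perm.mul_apply, ← pow_add, Nat.add_sub_cancel' h1]
  have hρinj : Function.Injective ρ := by
    have key : ∀ x x', τ x ≤ τ x' → ρ x = ρ x' → x = x' := by
      intro x x' hle h
      have h1 := hcancel (τ x) (τ x') x x' hle (by rw [← hρ, ← hρ, h])
      rcases Nat.eq_zero_or_pos ((τ x' : ℕ) - τ x) with h0 | h0
      · rw [h0] at h1
        exact hκ h1
      · exact absurd ⟨x, h1⟩ (hmin x' _ h0 (Nat.sub_lt (τ x').pos (τ x).pos))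
    intro x x' h
    rcases le_total (τ x) (τ x') with hle | hle
    exacts [key x x' hle h, (key x' x hle h.symm).symm]
  let e : Tower τ → Y := fun p => (π ^ p.lvl) (κ p.pt)
  have heinj : Function.Injective e := by
    have key : ∀ p q : Tower τ, p.lvl ≤ q.lvl → e p = e q → p = q := by
      intro p q hle h
      have h1 := hcancel p.lvl q.lvl _ _ hle h
      rcases Nat.eq_zero_or_pos (q.lvl - p.lvl) with h0 | h0
      · rw [h0] at h1
        ext
        · exact hκ h1
        · omega
      · exact absurd ⟨_, h1⟩ (hmin _ _ h0 (lt_of_le_of_lt (Nat.sub_le _ _) q.lt))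
    intro p q h
    rcases le_total p.lvl q.lvl with hle | hle
    exacts [key p q hle h, (key q p hle h.symm).symm]
  have hesurj : Function.Surjective e := by
    intro y
    -- Take the shortest way up to `y` from the base. If it were at least as long as the height over
    -- its starting point `x`, it would pass through `κ (ρ x)` and could be shortened.
    have hex : ∃ t : ℕ, ∃ x, (π ^ t) (κ x) = y := by
      obtain ⟨x, hx⟩ := hmeet y
      obtain ⟨t, ht⟩ := hx.exists_nat_pow_eq
      exact ⟨t, x, ht⟩
    obtain ⟨x, hx⟩ := Nat.find_spec hex
    refine ⟨⟨x, Nat.find hex, ?_⟩, hx⟩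
    by_contra hlt
    rw [not_lt] at hlt
    refine Nat.find_min hex (Nat.sub_lt ((τ x).pos.trans_le hlt) (τ x).pos) ⟨ρ x, ?_⟩
    rw [hρ, ← Perm.mul_apply, ← pow_add, Nat.sub_add_cancel hlt, hx]
  have hbij : Function.Bijective e := ⟨heinj, hesurj⟩
  refine ⟨τ, Equiv.ofBijective ρ (Finite.injective_iff_bijective.1 hρinj),
    Equiv.ofBijective e hbij, fun x => rfl, fun p => ?_⟩
  simp only [Equiv.ofBijective_apply]
  by_cases h : p.lvl + 1 < τ p.pt
  · rw [shift_of_lt _ h]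
    simp only [e]
    rw [pow_succ', Perm.mul_apply]
  · rw [shift_of_not_lt _ h]
    simp only [e, base_lvl, base_pt, Equiv.ofBijective_apply, pow_zero, Perm.one_apply]
    have h1 : (τ p.pt : ℕ) = p.lvl + 1 := by have := p.lt; omega
    rw [hρ, h1, pow_succ', Perm.mul_apply]

end Tower

/-! ### Free cyclic actions that commute with a commutator -/

/-- Let the powers of `e` act freely and commute with `f` and `u`. If the commutator of `u` and `f`
has at most one nontrivial cycle, and `e` maps a point of this cycle into the cycle, then `e` is
trivial: the transfer to the group of powers of `e` maps the commutator to the identity. -/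
theorem Equiv.Perm.eq_one_of_commute_of_commutator_cycle {Q : Type} [Finite Q] {e f u : Perm Q}
    (hfree : ∀ a ∈ Subgroup.zpowers e, ∀ q, a q = q → a = 1) (hf : Commute e f) (hu : Commute e u)
    {r : Q} (hfix : ∀ q, ¬ (u * f * u⁻¹ * f⁻¹).SameCycle r q → (u * f * u⁻¹ * f⁻¹) q = q)
    (her : (u * f * u⁻¹ * f⁻¹).SameCycle r (e r)) : e = 1 := by
  classical
  set t := u * f * u⁻¹ * f⁻¹ with ht
  let _ : CommGroup (Subgroup.zpowers e) :=
    { (inferInstance : Group (Subgroup.zpowers e)) with mul_comm := mul_comm' }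
  let X := Quotient (Perm.SameCycle.setoid e)
  have : Fintype X := Fintype.ofFinite X
  let cl : Q → X := Quotient.mk _
  let s : X → Q := Quotient.out
  have hs : ∀ x, cl (s x) = x := Quotient.out_eq
  have hcl : ∀ a ∈ Subgroup.zpowers e, ∀ q, cl (a q) = cl q := by
    rintro _ ⟨z, rfl⟩ q
    exact Quotient.sound (Perm.sameCycle_zpow_left.2 (Perm.SameCycle.refl _ _))
  -- `c q` is the coordinate of `q` in its orbit relative to the representative `s (cl q)`; by
  -- freeness it is unique (`hcu`).
  have hc : ∀ q, ∃ a : Subgroup.zpowers e, a.1 (s (cl q)) = q := fun q => by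
    obtain ⟨z, hz⟩ : e.SameCycle (s (cl q)) q := Quotient.exact (hs (cl q))
    exact ⟨⟨e ^ z, z, rfl⟩, hz⟩
  choose c hc using hc
  have hcu : ∀ q (a b : Subgroup.zpowers e), a.1 q = b.1 q → a = b := fun q a b h => by
    have h1 := hfree (b⁻¹ * a : Subgroup.zpowers e).1 (b⁻¹ * a).2 q
      (by simp [h])
    have h2 : b⁻¹ * a = 1 := Subtype.ext h1
    rw [← mul_one b, ← h2, mul_inv_cancel_left]
  have hcmul : ∀ (a : Subgroup.zpowers e) q, c (a.1 q) = a * c q := fun a q => by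
    apply hcu (s (cl q))
    have h1 := hc (a.1 q)
    rw [hcl _ a.2] at h1
    rw [h1, Subgroup.coe_mul, Perm.mul_apply, hc]
  let Z := Subgroup.centralizer {e}
  have hZ : ∀ π : Z, ∀ a ∈ Subgroup.zpowers e, ∀ q, π.1 (a q) = a (π.1 q) := by
    rintro π _ ⟨z, rfl⟩ q
    have h1 : Commute e π.1 := Subgroup.mem_centralizer_iff.1 π.2 e rfl
    have h2 := (h1.zpow_left z).eq
    exact (congr_fun (congr_arg DFunLike.coe h2) q).symm
  have hcπ : ∀ (π : Z) q, c (π.1 q) = c q * c (π.1 (s (cl q))) := fun π q => by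
    conv_lhs => rw [← hc q, hZ π _ (c q).2, hcmul]
  have hbar : ∀ (π : Z) q, cl (π.1 (s (cl q))) = cl (π.1 q) := fun π q => by
    conv_rhs => rw [← hc q, hZ π _ (c q).2, hcl _ (c q).2]
  let bar : Z → X → X := fun π x => cl (π.1 (s x))
  have hbarmul : ∀ (π σ : Z) x, bar (π * σ) x = bar π (bar σ x) := fun π σ x => by
    simp only [bar]
    rw [hbar]; rfl
  have hbarbij : ∀ π : Z, Function.Bijective (bar π) := fun π => by
    have h1 : ∀ x, bar 1 x = x := fun x => hs x
    refine Function.bijective_iff_has_inverse.2 ⟨bar π⁻¹, fun x => ?_, fun x => ?_⟩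
    · rw [← hbarmul, inv_mul_cancel, h1]
    · rw [← hbarmul, mul_inv_cancel, h1]
  -- The transfer: multiply the displacements over all orbits of `e`. The target is commutative, so
  -- the commutator `t` has trivial image.
  let hol : Z →* Subgroup.zpowers e := MonoidHom.mk' (fun π => ∏ x, c (π.1 (s x))) fun π σ => by
    have h1 : ∀ x, c ((π * σ).1 (s x)) = c (π.1 (s (bar σ x))) * c (σ.1 (s x)) := fun x => by
      rw [mul_comm, Subgroup.coe_mul, Perm.mul_apply, hcπ π]
    rw [Finset.prod_congr rfl fun x _ => h1 x, Finset.prod_mul_distrib]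
    congr 1
    exact Fintype.prod_bijective (bar σ) (hbarbij σ) _ _ fun x => rfl
  have hmem : ∀ g, Commute e g → g ∈ Z := fun g hg =>
    Subgroup.mem_centralizer_iff.2 (by rintro _ rfl; exact hg)
  let f' : Z := ⟨f, hmem f hf⟩
  let u' : Z := ⟨u, hmem u hu⟩
  have hhol : hol (u' * f' * u'⁻¹ * f'⁻¹) = 1 := by
    simp only [map_mul, map_inv]
    rw [mul_comm (hol u'), mul_inv_cancel_right, mul_inv_cancel]
  have hholt : ∏ x, c (t (s x)) = 1 := hhol
  have ht' : ∀ q, c (t (s (cl q))) = c (t q) / c q := fun q => by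
    rw [eq_div_iff_mul_eq', mul_comm]
    exact (hcπ (u' * f' * u'⁻¹ * f'⁻¹) q).symm
  have htmap : ∀ q q', cl q = cl q' → cl (t q) = cl (t q') := fun q q' h => by
    have := hbar (u' * f' * u'⁻¹ * f'⁻¹)
    have h1 := this q
    have h2 := this q'
    rw [h] at h1
    exact h1.symm.trans h2
  -- `k` is the first time at which the `t`-orbit of `r` returns to the `e`-orbit of `r`, possibly
  -- at another point.
  have hex : ∃ k : ℕ, 0 < k ∧ cl ((t ^ k) r) = cl r :=
    ⟨orderOf t, orderOf_pos t, by rw [pow_orderOf_eq_one]; rfl⟩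
  obtain ⟨hk0, hk⟩ := Nat.find_spec hex
  have hkmin := fun j => Nat.find_min (m := j) hex
  set k := Nat.find hex
  have htinj : ∀ q q', cl (t q) = cl (t q') → cl q = cl q' := fun q q' h => by
    have h1 := (hbarbij (u' * f' * u'⁻¹ * f'⁻¹)).1
    have h2 := hbar (u' * f' * u'⁻¹ * f'⁻¹)
    exact h1 ((h2 q).trans (h.trans (h2 q').symm))
  have hinj : ∀ i j, i ≤ j → j < k → cl ((t ^ i) r) = cl ((t ^ j) r) → i = j := by
    intro i j hij hj h
    induction i generalizing j with
    | zero =>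
      by_contra hne
      exact hkmin j hj ⟨Nat.pos_of_ne_zero (Ne.symm hne), h.symm⟩
    | succ i ih =>
      obtain ⟨j, rfl⟩ : ∃ j', j = j' + 1 := ⟨j - 1, by omega⟩
      rw [pow_succ', pow_succ', Perm.mul_apply, Perm.mul_apply] at h
      rw [ih j (by omega) (by omega) (htinj _ _ h)]
  -- Orbits of `e` not visited by the cycle of `r` contribute `1`, since `t` fixes their
  -- representatives; along the visited ones the product telescopes.
  have hprod : ∏ x, c (t (s x)) = c ((t ^ k) r) / c r := by
    rw [show c ((t ^ k) r) / c r = c ((t ^ k) r) / c ((t ^ 0) r) by rfl,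
      ← Finset.prod_range_div (fun j => c ((t ^ j) r)) k]
    have h1 : ∀ j ∈ Finset.range k, c ((t ^ (j + 1)) r) / c ((t ^ j) r) =
        c (t (s (cl ((t ^ j) r)))) := fun j _ => by
      rw [ht', pow_succ', Perm.mul_apply]
    rw [Finset.prod_congr rfl h1, ← Finset.prod_image (f := fun x => c (t (s x)))
      (g := fun j => cl ((t ^ j) r)) (s := Finset.range k)]
    · refine (Finset.prod_subset (Finset.subset_univ _) fun x _ hx => ?_).symm
      have hcs : c (s x) = 1 := hcu (s x) _ _ (by
        have h2 := hc (s x)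
        rw [hs] at h2
        exact h2)
      rw [hfix, hcs]
      rintro hcyc
      obtain ⟨m, hm⟩ := hcyc.exists_nat_pow_eq
      apply hx
      rw [← hs x, ← hm]
      clear hm hcyc hcs hx
      have hmod : ∀ m, cl ((t ^ m) r) = cl ((t ^ (m % k)) r) := by
        intro m
        induction m using Nat.strong_induction_on with
        | _ m ih =>
          by_cases hlt : m < k
          · rw [Nat.mod_eq_of_lt hlt]
          · rw [Nat.mod_eq_sub_mod (not_lt.1 hlt), ← ih (m - k) (by omega)]
            have h3 : ∀ j, cl ((t ^ (j + k)) r) = cl ((t ^ j) r) := by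
              intro j
              induction j with
              | zero => rw [zero_add]; exact hk
              | succ j ihj =>
                rw [add_right_comm, pow_succ', pow_succ', Perm.mul_apply, Perm.mul_apply]
                exact htmap _ _ ihj
            conv_lhs => rw [← Nat.sub_add_cancel (not_lt.1 hlt)]
            exact h3 _
      rw [hmod]
      exact Finset.mem_image.2 ⟨m % k, Finset.mem_range.2 (Nat.mod_lt _ hk0), rfl⟩
    · intro i hi j hj h
      rw [Finset.coe_range, Set.mem_Iio] at hi hj
      rcases le_total i j with hij | hij
      exacts [hinj i j hij hj h, (hinj j i hij hi h.symm).symm]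
  -- As the transfer of `t` is trivial, the first return to the `e`-orbit is at `r` itself. So the
  -- cycle of `r` meets that orbit only in `r`, and `e r`, which lies in both, equals `r`.
  have hkr : (t ^ k) r = r := by
    have h1 : c ((t ^ k) r) = c r := by
      rw [← div_eq_one, ← hprod, hholt]
    have h2 := hc ((t ^ k) r)
    rw [hk, h1, hc] at h2
    exact h2.symm
  obtain ⟨m, hm⟩ := her.exists_nat_pow_eq
  have hred : ∀ m, (t ^ m) r = (t ^ (m % k)) r := fun m => by
    conv_lhs => rw [← Nat.mod_add_div m k, pow_add, Perm.mul_apply, pow_mul]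
    congr 1
    induction m / k with
    | zero => rfl
    | succ j ih => rw [pow_succ, Perm.mul_apply, hkr, ih]
  rw [hred] at hm
  have h0 : 0 = m % k := hinj 0 _ (Nat.zero_le _) (Nat.mod_lt _ hk0) (by
    rw [hm, hcl _ (Subgroup.mem_zpowers e)]; rfl)
  rw [← h0] at hm
  exact hfree e (Subgroup.mem_zpowers e) r hm.symm

/-! ### Square-tiled surfaces -/

namespace SquareGluing

variable {Q : Type} (S : SquareGluing Q)

theorem bottomLeft_eq_iff {q q' : Q} :
    S.bottomLeft q = S.bottomLeft q' ↔ S.turn.SameCycle q q' := Quotient.eq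

theorem bottomLeft_turn (q : Q) : S.bottomLeft (S.turn q) = S.bottomLeft q :=
  S.bottomLeft_eq_iff.2 (Perm.sameCycle_apply_left.2 (Perm.SameCycle.refl _ _))

/-- The commutator without inverses: it compares the two ways to the square diagonally above `q`. -/
theorem turn_right_up (q : Q) : S.turn (S.right (S.up q)) = S.up (S.right q) := by
  simp [turn]

theorem forall_of_closed [Finite Q] {P : Q → Prop} (hr : ∀ q, P q → P (S.right q))
    (hu : ∀ q, P q → P (S.up q)) {q : Q} (hq : P q) (q' : Q) : P q' :=
  (isPretransitive_closure_pair_iff _ _).1 S.connected P hr hu q q' hq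

end SquareGluing

/-! ### Isomorphisms of square-tiled surfaces and their rigidity. -/

namespace MinimalSurface

variable {g : ℕ} {Q Q' : Type}

/-- The surface given by two permutations and a square whose bottom left corner is the
singularity. -/
def ofPerms (g : ℕ) (f u : Perm Q) (r : Q)
    (hconn : MulAction.IsPretransitive (Subgroup.closure {f, u}) Q)
    (hcard : Nat.card {q // (u * f * u⁻¹ * f⁻¹).SameCycle q r} = 2 * g - 2 + 1)
    (hfix : ∀ q, ¬ (u * f * u⁻¹ * f⁻¹).SameCycle q r → (u * f * u⁻¹ * f⁻¹) q = q) :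
    MinimalSurface g Q where
  right := f
  up := u
  connected := hconn
  zero := Quotient.mk _ r
  multiplicity_zero := by
    rw [← hcard]
    exact Nat.card_congr (Equiv.subtypeEquivRight fun q => SquareGluing.bottomLeft_eq_iff _)
  multiplicity_other := by
    rintro ⟨q⟩ hq
    have h1 : (u * f * u⁻¹ * f⁻¹) q = q := hfix q fun h => hq (Quotient.sound h)
    refine Nat.card_eq_one_iff_unique.2 ⟨⟨?_⟩, ⟨⟨q, rfl⟩⟩⟩
    have h2 : ∀ p : {p // Quotient.mk (Perm.SameCycle.setoid (u * f * u⁻¹ * f⁻¹)) p =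
        Quotient.mk _ q}, p.1 = q := fun p =>
      (Perm.SameCycle.eq_of_right (Quotient.exact p.2) h1)
    exact fun p p' => Subtype.ext ((h2 p).trans (h2 p').symm)

theorem bottomLeft_ofPerms {f u : Perm Q} {r : Q} (h₁ h₂ h₃) (q : Q) :
    (ofPerms g f u r h₁ h₂ h₃).bottomLeft q = (ofPerms g f u r h₁ h₂ h₃).zero ↔
      (u * f * u⁻¹ * f⁻¹).SameCycle q r :=
  SquareGluing.bottomLeft_eq_iff _

variable (S : MinimalSurface g Q) (T : MinimalSurface g Q')

theorem turn_eq_self {q : Q} (hq : S.bottomLeft q ≠ S.zero) : S.turn q = q := by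
  have h := (Nat.card_eq_one_iff_unique.1 (S.multiplicity_other _ hq)).1
  exact congr_arg Subtype.val
    (Subsingleton.elim (⟨S.turn q, S.bottomLeft_turn q⟩ : {p // S.bottomLeft p = S.bottomLeft q})
      ⟨q, rfl⟩)

/-- The squares whose bottom left corner is the singularity. -/
def Corner : Type := {q : Q // S.bottomLeft q = S.zero}

theorem card_corner : Nat.card S.Corner = 2 * g - 2 + 1 := S.multiplicity_zero

theorem exists_corner : ∃ r, S.bottomLeft r = S.zero := by
  obtain ⟨r, hr⟩ := Quotient.exists_rep S.zero
  exact ⟨r, hr⟩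

/-- The bijections between squares that are isomorphisms of surfaces. -/
def IsIso (e : Q ≃ Q') : Prop :=
  (∀ q, e (S.right q) = T.right (e q)) ∧ (∀ q, e (S.up q) = T.up (e q)) ∧
    ∀ q, S.bottomLeft q = S.zero ↔ T.bottomLeft (e q) = T.zero

namespace IsIso

variable {S T} {e : Q ≃ Q'}

theorem symm (h : S.IsIso T e) : T.IsIso S e.symm := by
  obtain ⟨h1, h2, h3⟩ := h
  refine ⟨fun q => ?_, fun q => ?_, fun q => ?_⟩
  · rw [Equiv.symm_apply_eq, h1, Equiv.apply_symm_apply]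
  · rw [Equiv.symm_apply_eq, h2, Equiv.apply_symm_apply]
  · rw [h3, Equiv.apply_symm_apply]

theorem trans {Q'' : Type} {U : MinimalSurface g Q''} {e' : Q' ≃ Q''} (h : S.IsIso T e)
    (h' : T.IsIso U e') : S.IsIso U (e.trans e') := by
  obtain ⟨h1, h2, h3⟩ := h
  obtain ⟨k1, k2, k3⟩ := h'
  exact ⟨fun q => by simp [h1, k1], fun q => by simp [h2, k2], fun q => by rw [h3, k3]; rfl⟩

theorem apply_turn (h1 : ∀ q, e (S.right q) = T.right (e q)) (h2 : ∀ q, e (S.up q) = T.up (e q))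
    (q : Q) : e (S.turn q) = T.turn (e q) := by
  obtain ⟨p, rfl⟩ : ∃ p, q = S.right (S.up p) := ⟨S.up.symm (S.right.symm q), by simp⟩
  rw [S.turn_right_up, h2, h1, h1, h2, T.turn_right_up]

/-- It is sufficient that one square at the singularity is mapped to a square at the
singularity. -/
theorem of_corner (h1 : ∀ q, e (S.right q) = T.right (e q)) (h2 : ∀ q, e (S.up q) = T.up (e q))
    {r : Q} (hr : S.bottomLeft r = S.zero) (hr' : T.bottomLeft (e r) = T.zero) : S.IsIso T e := by
  refine ⟨h1, h2, fun q => ?_⟩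
  rw [← hr, ← hr', S.bottomLeft_eq_iff, T.bottomLeft_eq_iff]
  have key := IsCycleLabel.intertwine_zpow (apply_turn h1 h2)
  constructor
  · rintro ⟨z, rfl⟩
    exact ⟨z, (key z q).symm⟩
  · rintro ⟨z, hz⟩
    exact ⟨z, e.injective ((key z q).trans hz)⟩

/-- The set where two isomorphisms agree is closed under `right` and `up`; connectedness does the
rest. In particular automorphisms act freely. -/
theorem ext_of_apply_eq [Finite Q] {e' : Q ≃ Q'} (h : S.IsIso T e) (h' : S.IsIso T e') {q : Q}
    (hq : e q = e' q) : e = e' := by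
  ext p
  refine S.forall_of_closed (P := fun p => e p = e' p) (fun p hp => ?_) (fun p hp => ?_) hq p
  · rw [h.1, h'.1, hp]
  · rw [h.2.1, h'.2.1, hp]

theorem bottomInSaddleGraph_iff (h : S.IsIso T e) (q : Q) :
    S.BottomInSaddleGraph q ↔ T.BottomInSaddleGraph (e q) := by
  have key := IsCycleLabel.intertwine_zpow h.1
  constructor
  · rintro ⟨_, ⟨z, rfl⟩, hp⟩
    exact ⟨_, ⟨z, rfl⟩, by rw [← key, ← h.2.2, hp]⟩
  · rintro ⟨_, ⟨z, rfl⟩, hp⟩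
    exact ⟨_, ⟨z, rfl⟩, by rw [h.2.2, key, hp]⟩

theorem eqvGen_adjacent (h : S.IsIso T e) {p q : Q} (hpq : Relation.EqvGen S.Adjacent p q) :
    Relation.EqvGen T.Adjacent (e p) (e q) := by
  induction hpq with
  | rel p q hpq =>
    refine Relation.EqvGen.rel _ _ ?_
    rcases hpq with rfl | ⟨rfl, hq⟩
    · exact Or.inl (h.1 _)
    · exact Or.inr ⟨h.2.1 _, by rwa [← h.bottomInSaddleGraph_iff]⟩
  | refl p => exact Relation.EqvGen.refl _
  | symm p q _ ih => exact ih.symm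
  | trans p q s _ _ ih ih' => exact ih.trans _ _ _ ih'

theorem eqvGen_adjacent_iff (h : S.IsIso T e) {p q : Q} :
    Relation.EqvGen S.Adjacent p q ↔ Relation.EqvGen T.Adjacent (e p) (e q) :=
  ⟨h.eqvGen_adjacent, fun hpq => by simpa using h.symm.eqvGen_adjacent hpq⟩

theorem numCylinders_eq (h : S.IsIso T e) : S.numCylinders = T.numCylinders :=
  Nat.card_congr (Quotient.congr e fun _ _ => h.eqvGen_adjacent_iff)

end IsIso

/-- A square-tiled surface in a minimal stratum has no nontrivial automorphisms. -/
theorem eq_refl_of_isIso [Finite Q] {e : Q ≃ Q} (h : S.IsIso S e) : e = Equiv.refl Q := by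
  obtain ⟨r, hr⟩ := S.exists_corner
  have hpow : ∀ a ∈ Subgroup.zpowers (e : Perm Q), S.IsIso S a := by
    rintro _ ⟨z, rfl⟩
    simp only
    induction z with
    | zero => exact ⟨fun _ => rfl, fun _ => rfl, fun _ => Iff.rfl⟩
    | succ n ih => rw [add_comm, zpow_one_add]; exact ih.trans h
    | pred n ih => rw [sub_eq_neg_add, zpow_add, zpow_neg_one]; exact ih.trans h.symm
  refine Equiv.Perm.eq_one_of_commute_of_commutator_cycle (Q := Q) (e := e) (f := S.right)
    (u := S.up) (r := r) (fun a ha q hq => ?_) (Equiv.ext h.1) (Equiv.ext h.2.1) (fun q hq => ?_) ?_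
  · exact (hpow a ha).ext_of_apply_eq (hpow 1 (one_mem _)) (q := q) hq
  · refine S.turn_eq_self fun hq' => hq ?_
    exact S.bottomLeft_eq_iff.1 (hr.trans hq'.symm)
  · exact S.bottomLeft_eq_iff.1 (hr.trans ((h.2.2 r).1 hr).symm)

/-- Transport of structure, needed because the isomorphism classes are formed from surfaces on `Fin
d`. -/
theorem exists_isIso [Finite Q] (e : Q ≃ Q') : ∃ T : MinimalSurface g Q', S.IsIso T e := by
  obtain ⟨r, hr⟩ := S.exists_corner
  have hQ' : Finite Q' := Finite.of_equiv Q e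
  let f : Perm Q' := e.permCongr S.right
  let u : Perm Q' := e.permCongr S.up
  have ht : ∀ q, (u * f * u⁻¹ * f⁻¹) (e q) = e (S.turn q) := fun q => by
    have hf : ∀ q, f (e q) = e (S.right q) := fun q => by simp [f, Equiv.permCongr_apply]
    have hu : ∀ q, u (e q) = e (S.up q) := fun q => by simp [u, Equiv.permCongr_apply]
    obtain ⟨p, rfl⟩ : ∃ p, q = S.right (S.up p) := ⟨S.up.symm (S.right.symm q), by simp⟩
    rw [S.turn_right_up, ← hf, ← hu, ← hu, ← hf]
    simp [-Equiv.permCongr_apply]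
  have hcyc : ∀ q q', (u * f * u⁻¹ * f⁻¹).SameCycle (e q) (e q') ↔ S.turn.SameCycle q q' := by
    intro q q'
    have key := IsCycleLabel.intertwine_zpow (fun q => (ht q).symm)
    constructor
    · rintro ⟨z, hz⟩
      exact ⟨z, e.injective ((key z q).trans hz)⟩
    · rintro ⟨z, rfl⟩
      exact ⟨z, (key z q).symm⟩
  refine ⟨ofPerms g f u (e r) ?_ ?_ ?_, ?_⟩
  · rw [isPretransitive_closure_pair_iff]
    intro P hf hu x y hx
    have h1 := S.forall_of_closed (P := fun q => P (e q)) (fun q hq => ?_) (fun q hq => ?_)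
      (q := e.symm x) (by simpa using hx) (e.symm y)
    · simpa using h1
    · simpa [f, Equiv.permCongr_apply] using hf _ hq
    · simpa [u, Equiv.permCongr_apply] using hu _ hq
  · rw [← S.card_corner]
    refine Nat.card_congr (Equiv.subtypeEquiv e.symm fun q => ?_)
    rw [← hr, S.bottomLeft_eq_iff, ← hcyc, apply_symm_apply]
  · intro q hq
    obtain ⟨q, rfl⟩ := e.surjective q
    rw [ht, S.turn_eq_self]
    rwa [hcyc, ← S.bottomLeft_eq_iff, hr] at hq
  · refine IsIso.of_corner (fun q => ?_) (fun q => ?_) hr ?_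
    · simp [ofPerms, f, Equiv.permCongr_apply]
    · simp [ofPerms, u, Equiv.permCongr_apply]
    · rfl

end MinimalSurface

theorem Equiv.Perm.SameCycle.iff_of_closed {X : Type} [Finite X] {f : Perm X} {P : X → Prop}
    (h : ∀ x, P x → P (f x)) {x y : X} (hxy : f.SameCycle x y) : P x ↔ P y := by
  have key : ∀ {x y : X}, f.SameCycle x y → P x → P y := fun {x y} hxy hx => by
    obtain ⟨n, rfl⟩ := hxy.exists_nat_pow_eq
    clear hxy
    induction n with
    | zero => exact hx
    | succ n ih => rw [pow_succ', Perm.mul_apply]; exact h _ ih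
  exact ⟨key hxy, key hxy.symm⟩

/-! ### Surfaces built from cylinders -/

/-- The data that determine a square-tiled surface in a minimal stratum. The set `C` indexes the
horizontal saddle connections, and `W` is the rotation around the singularity. The lower boundaries
of the cylinders are the cycles of `perm`, with the lengths `len`; the upper boundaries are the
cycles of `W * perm`. The function `roof` gives the heights of the cylinders, and `gluing` maps the
lowest row of squares of each cylinder to the lowest rows of squares above the cylinder. -/
@[ext]
structure CylinderDatum {C : Type} (W : Perm C) : Type where
  /-- the first return map of the horizontal flow on lower boundaries of cylinders -/
  perm : Perm C
  /-- the lengths of the horizontal saddle connections -/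
  len : C → ℕ+
  /-- the heights of the cylinders -/
  roof : Tower len → ℕ+
  /-- the first return map of the vertical flow -/
  gluing : Perm (Tower len)
  roof_row : ∀ x, roof (Tower.shift len perm x) = roof x
  gluing_comm : ∀ x, gluing (Tower.shift len perm x) = Tower.shift len (W * perm) (gluing x)

namespace CylinderDatum

variable {C : Type} {W : Perm C} (D : CylinderDatum W)

/-- The squares. -/
abbrev Square : Type := Tower D.roof

/-- The square to the right. -/
def right : Perm D.Square := Tower.lift D.roof (Tower.shift D.len D.perm) D.roof_row

/-- The square above. -/
def up : Perm D.Square := Tower.shift D.roof D.gluing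

/-- The square whose bottom side is the initial segment of a saddle connection. -/
def corner (c : C) : D.Square := Tower.base D.roof (Tower.base D.len c)

theorem corner_injective : Function.Injective D.corner :=
  Tower.base_injective.comp Tower.base_injective

/-- The rotation around the vertices. -/
def turn : Perm D.Square := D.up * D.right * D.up⁻¹ * D.right⁻¹

theorem turn_right_up (q : D.Square) : D.turn (D.right (D.up q)) = D.up (D.right q) := by
  simp [turn]

theorem right_base (y : Tower D.len) :
    D.right (Tower.base D.roof y) = Tower.base D.roof (Tower.shift D.len D.perm y) := rfl

theorem right_lvl (q : D.Square) : (D.right q).lvl = q.lvl := rfl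

theorem right_pt (q : D.Square) : (D.right q).pt = Tower.shift D.len D.perm q.pt := rfl

/-- Inside a cylinder `right` and `up` commute, because `roof` is constant along rows. -/
theorem turn_of_lvl_ne {q : D.Square} (hq : q.lvl ≠ 0) : D.turn q = q := by
  obtain ⟨p, rfl⟩ : ∃ p, q = D.right (D.up p) := ⟨D.up.symm (D.right.symm q), by simp⟩
  rw [turn_right_up]
  by_cases h : p.lvl + 1 < D.roof p.pt
  · have h' : (D.right p).lvl + 1 < D.roof (D.right p).pt := by
      rw [right_lvl, right_pt, D.roof_row]; exact h
    rw [up, Tower.shift_of_lt _ h, Tower.shift_of_lt _ h']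
    rfl
  · rw [right_lvl, up, Tower.shift_of_not_lt _ h] at hq
    exact absurd rfl hq

/-- A bottom row continues by `perm` when seen from the cylinder above it and by `W * perm` when
seen from the one below; `gluing_comm` says that `turn` takes the first continuation to the second.
-/
theorem turn_base (y : Tower D.len) :
    D.turn (Tower.base D.roof (Tower.shift D.len D.perm y)) =
      Tower.base D.roof (Tower.shift D.len (W * D.perm) y) := by
  have h1 : Tower.base D.roof y = D.up (Tower.top D.roof (D.gluing.symm y)) := by
    rw [up, Tower.shift_top, apply_symm_apply]
  have h2 : D.right (Tower.top D.roof (D.gluing.symm y)) =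
      Tower.top D.roof (Tower.shift D.len D.perm (D.gluing.symm y)) := by
    refine Tower.ext rfl ?_
    rw [right_lvl]
    simp only [Tower.top, D.roof_row]
  rw [← right_base, h1, turn_right_up, h2, up, Tower.shift_top, D.gluing_comm, apply_symm_apply]

theorem turn_corner (c : C) : D.turn (D.corner c) = D.corner (W c) := by
  have h := D.turn_base (Tower.top D.len (D.perm.symm c))
  rw [Tower.shift_top, Tower.shift_top, Perm.mul_apply, apply_symm_apply] at h
  exact h

theorem turn_of_ne_corner {q : D.Square} (hq : ∀ c, q ≠ D.corner c) : D.turn q = q := by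
  by_cases h : q.lvl = 0
  · rw [Tower.eq_base h] at hq ⊢
    obtain ⟨y, hy⟩ := (Tower.shift D.len D.perm).surjective q.pt
    rw [← hy] at hq ⊢
    rw [turn_base]
    by_cases hlt : y.lvl + 1 < D.len y.pt
    · rw [Tower.shift_of_lt _ hlt, Tower.shift_of_lt _ hlt]
    · refine absurd ?_ (hq (D.perm y.pt))
      rw [Tower.shift_of_not_lt _ hlt]
      rfl
  · exact D.turn_of_lvl_ne h

theorem turn_zpow_corner (z : ℤ) (c : C) : (D.turn ^ z) (D.corner c) = D.corner ((W ^ z) c) :=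
  (IsCycleLabel.intertwine_zpow (fun c => (D.turn_corner c).symm) z c).symm

/-- As `W` is a single cycle, the corners form a single vertex, with as many squares as `C` has
elements. -/
theorem sameCycle_turn_corner_iff {c₀ : C} (hW : ∀ c, W.SameCycle c₀ c) (q : D.Square) :
    D.turn.SameCycle q (D.corner c₀) ↔ ∃ c, D.corner c = q := by
  constructor
  · intro h
    obtain ⟨z, rfl⟩ := h.symm
    exact ⟨_, (D.turn_zpow_corner z c₀).symm⟩
  · rintro ⟨c, rfl⟩
    obtain ⟨z, rfl⟩ := hW c
    exact Perm.SameCycle.symm ⟨z, D.turn_zpow_corner z c₀⟩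

theorem sameCycle_up_base (q : D.Square) : D.up.SameCycle (Tower.base D.roof q.pt) q :=
  ⟨q.lvl, by rw [zpow_natCast]; exact Tower.shift_pow_base D.gluing q⟩

theorem right_zpow_base (z : ℤ) (y : Tower D.len) :
    (D.right ^ z) (Tower.base D.roof y) =
      Tower.base D.roof ((Tower.shift D.len D.perm ^ z) y) :=
  (IsCycleLabel.intertwine_zpow (fun y => (D.right_base y).symm) z y).symm

theorem sameCycle_right_corner (y : Tower D.len) :
    D.right.SameCycle (D.corner y.pt) (Tower.base D.roof y) :=
  ⟨y.lvl, by rw [corner, right_zpow_base, zpow_natCast, Tower.shift_pow_base]⟩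

variable [Finite C]

/-- Connectedness is automatic: each square is reached vertically from a bottom row, each bottom row
contains a corner, and all corners lie at one vertex. -/
theorem isPretransitive {c₀ : C} (hW : ∀ c, W.SameCycle c₀ c) :
    MulAction.IsPretransitive (Subgroup.closure {D.right, D.up}) D.Square := by
  rw [isPretransitive_closure_pair_iff]
  intro P hr hu
  have ht : ∀ q, P q → P (D.turn q) := fun q hq =>
    hu _ (hr _ (Perm.inv_apply_of_forall hu (Perm.inv_apply_of_forall hr hq)))
  have key : ∀ q, P q ↔ P (D.corner c₀) := fun q => by
    rw [← (D.sameCycle_up_base q).iff_of_closed hu,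
      ← (D.sameCycle_right_corner q.pt).iff_of_closed hr]
    exact ((D.sameCycle_turn_corner_iff hW _).2 ⟨_, rfl⟩).iff_of_closed ht
  exact fun x y hx => (key y).2 ((key x).1 hx)

variable {g : ℕ} {c₀ : C} (hW : ∀ c, W.SameCycle c₀ c) (hC : Nat.card C = 2 * g - 2 + 1)

/-- The square-tiled surface with given cylinders. -/
def surface : MinimalSurface g D.Square :=
  MinimalSurface.ofPerms g D.right D.up (D.corner c₀) (D.isPretransitive hW)
    (by
      rw [← hC]
      refine Nat.card_congr ((Equiv.subtypeEquivRight fun q => ?_).trans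
        (Equiv.ofInjective D.corner D.corner_injective).symm)
      exact D.sameCycle_turn_corner_iff hW q)
    fun q hq => D.turn_of_ne_corner fun c hc =>
      hq ((D.sameCycle_turn_corner_iff hW q).2 ⟨c, hc.symm⟩)

theorem bottomLeft_surface_iff (q : D.Square) :
    (D.surface hW hC).bottomLeft q = (D.surface hW hC).zero ↔ ∃ c, D.corner c = q :=
  (MinimalSurface.bottomLeft_ofPerms _ _ _ q).trans (D.sameCycle_turn_corner_iff hW q)

theorem bottomInSaddleGraph_iff (q : D.Square) :
    (D.surface hW hC).BottomInSaddleGraph q ↔ q.lvl = 0 := by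
  constructor
  · rintro ⟨p, hp, h⟩
    obtain ⟨c, rfl⟩ := (D.bottomLeft_surface_iff hW hC p).1 h
    obtain ⟨z, hz⟩ := hp.symm
    rw [← hz]
    exact congr_arg Tower.lvl (D.right_zpow_base z _)
  · intro h
    refine ⟨D.corner q.pt.pt, ?_, (D.bottomLeft_surface_iff hW hC _).2 ⟨_, rfl⟩⟩
    have h1 := D.sameCycle_right_corner q.pt
    rw [← Tower.eq_base h] at h1
    exact h1.symm

/-- The cylinders are the cycles of `perm`. -/
theorem eqvGen_adjacent_iff (q q' : D.Square) :
    Relation.EqvGen (D.surface hW hC).Adjacent q q' ↔ D.perm.SameCycle q.pt.pt q'.pt.pt := by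
  constructor
  · intro h
    induction h with
    | rel p q h =>
      rcases h with rfl | ⟨rfl, h⟩
      · exact (Tower.sameCycle_shift_iff D.perm _ _).1
          (Perm.sameCycle_apply_right.2 (Perm.SameCycle.refl _ _))
      · rw [bottomInSaddleGraph_iff] at h
        change ¬ (Tower.shift D.roof D.gluing p).lvl = 0 at h
        change D.perm.SameCycle p.pt.pt (Tower.shift D.roof D.gluing p).pt.pt
        by_cases hlt : p.lvl + 1 < D.roof p.pt
        · rw [Tower.shift_of_lt _ hlt]
        · rw [Tower.shift_of_not_lt _ hlt] at h
          exact absurd rfl h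
    | refl => exact Perm.SameCycle.refl _ _
    | symm _ _ _ ih => exact ih.symm
    | trans _ _ _ _ _ ih ih' => exact ih.trans ih'
  · set r := Relation.EqvGen (D.surface hW hC).Adjacent with hr
    have hright : ∀ q, r q (D.right q) := fun q => Relation.EqvGen.rel _ _ (Or.inl rfl)
    have h1 : ∀ q, r (Tower.base D.roof q.pt) q := by
      intro q
      induction q using Tower.induction_up with
      | h0 x => exact Relation.EqvGen.refl _
      | h1 x s hs ih =>
        refine ih.trans _ _ _ (Relation.EqvGen.rel _ _ (Or.inr ⟨?_, ?_⟩))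
        · exact (Tower.shift_of_lt D.gluing (p := ⟨x, s, Nat.lt_of_succ_lt hs⟩) hs).symm
        · rw [bottomInSaddleGraph_iff]
          exact Nat.succ_ne_zero s
    have h2 : ∀ y : Tower D.len, r (D.corner y.pt) (Tower.base D.roof y) := by
      intro y
      induction y using Tower.induction_up with
      | h0 x => exact Relation.EqvGen.refl _
      | h1 x s hs ih =>
        have h3 := hright (Tower.base D.roof ⟨x, s, Nat.lt_of_succ_lt hs⟩)
        rw [right_base, Tower.shift_of_lt D.perm (p := ⟨x, s, Nat.lt_of_succ_lt hs⟩) hs] at h3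
        exact ih.trans _ _ _ h3
    have h3 : ∀ c, r (D.corner c) (D.corner (D.perm c)) := fun c => by
      have h4 := hright (Tower.base D.roof (Tower.top D.len c))
      rw [right_base, Tower.shift_top] at h4
      exact (h2 (Tower.top D.len c)).trans _ _ _ h4
    intro h
    refine ((h1 q).symm.trans _ _ _ (h2 q.pt).symm).trans _ _ _ (Relation.EqvGen.trans _ _ _ ?_
      ((h2 q'.pt).trans _ _ _ (h1 q')))
    exact (h.iff_of_closed (P := fun c => r (D.corner q.pt.pt) (D.corner c))
      fun c hc => hc.trans _ _ _ (h3 c)).1 (Relation.EqvGen.refl _)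

theorem numCylinders_surface : (D.surface hW hC).numCylinders =
    Nat.card (Quotient (Perm.SameCycle.setoid D.perm)) := by
  refine Nat.card_congr (Equiv.ofBijective (Quotient.map (fun q : D.Square => q.pt.pt)
    fun q q' h => (D.eqvGen_adjacent_iff hW hC q q').1 h) ⟨?_, ?_⟩)
  · rintro ⟨q⟩ ⟨q'⟩ h
    exact Quotient.sound ((D.eqvGen_adjacent_iff hW hC q q').2 (Quotient.exact h))
  · rintro ⟨c⟩
    exact ⟨Quotient.mk _ (D.corner c), rfl⟩

/-- A surface with a chosen square at the singularity determines its cylinders. -/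
theorem eq_of_isIso {D D' : CylinderDatum W} {e : D.Square ≃ D'.Square}
    (h : (D.surface hW hC).IsIso (D'.surface hW hC) e) (h₀ : e (D.corner c₀) = D'.corner c₀) :
    D = D' := by
  have hright : ∀ q, e (D.right q) = D'.right (e q) := h.1
  have hup : ∀ q, e (D.up q) = D'.up (e q) := h.2.1
  clear h
  have hturn : ∀ q, e (D.turn q) = D'.turn (e q) := fun q => by
    obtain ⟨p, rfl⟩ : ∃ p, q = D.right (D.up p) := ⟨D.up.symm (D.right.symm q), by simp⟩
    rw [D.turn_right_up, hup, hright, hright, hup, D'.turn_right_up]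
  have hcorner : ∀ c, e (D.corner c) = D'.corner c := by
    intro c
    obtain ⟨z, rfl⟩ := hW c
    have h1 := IsCycleLabel.intertwine_zpow (f := D.turn) (g := D'.turn) (e := e)
      hturn z (D.corner c₀)
    rwa [turn_zpow_corner, h₀, turn_zpow_corner] at h1
  -- Uniqueness of towers is used twice: for the horizontal flow over the corners, then for the
  -- vertical flow over the saddle connections just identified.
  obtain ⟨hlen, hperm, hbase⟩ := Tower.unique (π := D'.right) (ρ := D.perm) (ρ' := D'.perm)
    (e := fun y => e (Tower.base D.roof y)) (e' := Tower.base D'.roof)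
    (e.injective.comp Tower.base_injective) Tower.base_injective
    (fun y => by rw [← D.right_base, hright]) (fun y => (D'.right_base y).symm) hcorner
  obtain ⟨perm, len, roof, gluing, h1, h2⟩ := D
  obtain ⟨perm', len', roof', gluing', h1', h2'⟩ := D'
  simp only at hlen hperm hbase
  subst hlen hperm
  obtain ⟨hroof, hgluing, -⟩ := Tower.unique (e := e) (e' := id) (ρ := gluing) (ρ' := gluing')
    (π := Tower.shift roof' gluing') e.injective Function.injective_id hup (fun _ => rfl)
    (fun y => hbase y y.lt)
  subst hroof hgluing
  rfl

end CylinderDatum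

/-- Two cyclic permutations of sets of the same cardinality are conjugate. -/
theorem exists_conj_of_forall_sameCycle {X Y : Type} [Finite X] [Finite Y] {f : Perm X}
    {g : Perm Y} {x₀ : X} {y₀ : Y} (hf : ∀ x, f.SameCycle x₀ x) (hg : ∀ y, g.SameCycle y₀ y)
    (hcard : Nat.card X = Nat.card Y) : ∃ e : X ≃ Y, (∀ x, e (f x) = g (e x)) ∧ e x₀ = y₀ := by
  obtain ⟨e, h1, -, h2⟩ := (IsCycleLabel.of_forall_sameCycle x₀ hf).exists_conj
    (IsCycleLabel.of_forall_sameCycle y₀ hg) (x₀ := fun _ => x₀) (y₀ := fun _ => y₀)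
    (fun i => by
      rw [Nat.card_congr (Equiv.subtypeUnivEquiv fun _ => rfl), hcard,
        Nat.card_congr (Equiv.subtypeUnivEquiv fun _ => rfl)])
    (fun _ => rfl) (fun _ => rfl)
  exact ⟨e, h1, h2 ()⟩

/-! ### Cutting a surface along its horizontal saddle connections. -/

namespace MinimalSurface

variable {g : ℕ} {Q : Type} (S : MinimalSurface g Q)

theorem bottomInSaddleGraph_right_iff (q : Q) :
    S.BottomInSaddleGraph (S.right q) ↔ S.BottomInSaddleGraph q := by
  simp only [BottomInSaddleGraph, Perm.sameCycle_apply_left]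

theorem bottomInSaddleGraph_of_corner {q : Q} (hq : S.bottomLeft q = S.zero) :
    S.BottomInSaddleGraph q := ⟨q, Perm.SameCycle.refl _ _, hq⟩

/-- The vertex to the right of the side above `q` lies on the same horizontal line, which avoids the
singularity, so it is regular. -/
theorem up_right_of_not {q : Q} (hq : ¬ S.BottomInSaddleGraph (S.up q)) :
    S.up (S.right q) = S.right (S.up q) := by
  rw [← S.turn_right_up, S.turn_eq_self]
  intro h
  exact hq ((S.bottomInSaddleGraph_right_iff _).1 (S.bottomInSaddleGraph_of_corner h))

/-- Every vertical line meets the horizontal saddle connections. -/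
theorem exists_sameCycle_up [Finite Q] (q : Q) :
    ∃ b, S.BottomInSaddleGraph b ∧ S.up.SameCycle b q := by
  by_contra h
  obtain ⟨r, hr⟩ := S.exists_corner
  refine S.forall_of_closed
    (P := fun q => ¬ ∃ b, S.BottomInSaddleGraph b ∧ S.up.SameCycle b q) (fun q hq => ?_)
    (fun q hq => ?_) h r ⟨r, S.bottomInSaddleGraph_of_corner hr, Perm.SameCycle.refl _ _⟩
  -- A vertical line that avoids the saddle graph can be pushed one step to the right, and it still
  -- avoids it. By connectedness such lines would reach the singularity.
  · rintro ⟨b, hb, hbq⟩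
    obtain ⟨n, hn⟩ := hbq.symm.exists_nat_pow_eq
    have h1 : ∀ n : ℕ, ¬ S.BottomInSaddleGraph ((S.up ^ n) q) := fun n hn =>
      hq ⟨_, hn, Perm.SameCycle.symm ⟨n, by rw [zpow_natCast]⟩⟩
    have h2 : ∀ n : ℕ, (S.up ^ n) (S.right q) = S.right ((S.up ^ n) q) := fun n => by
      induction n with
      | zero => rfl
      | succ n ih =>
        rw [pow_succ', Perm.mul_apply, Perm.mul_apply, ih, S.up_right_of_not]
        have := h1 (n + 1)
        rwa [pow_succ', Perm.mul_apply] at this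
    rw [← hn, h2, S.bottomInSaddleGraph_right_iff] at hb
    exact h1 n hb
  · simpa only [Perm.sameCycle_apply_right] using hq

end MinimalSurface

/-- Every square-tiled surface with a chosen square at the singularity is built from cylinders. -/
theorem CylinderDatum.exists_isIso {C : Type} [Finite C] {W : Perm C} {c₀ : C} {g : ℕ}
    (hW : ∀ c, W.SameCycle c₀ c) (hC : Nat.card C = 2 * g - 2 + 1) {Q : Type} [Finite Q]
    (S : MinimalSurface g Q) {r : Q} (hr : S.bottomLeft r = S.zero) :
    ∃ (D : CylinderDatum W) (e : D.Square ≃ Q), (D.surface hW hC).IsIso S e ∧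
      e (D.corner c₀) = r := by
  have hturn : ∀ q, S.bottomLeft (S.turn q) = S.zero ↔ S.bottomLeft q = S.zero := fun q => by
    rw [S.bottomLeft_turn]
  have : Finite S.Corner := Subtype.finite
  -- Number the corners by `C` so that `turn` becomes `W` and the chosen root becomes `c₀`.
  obtain ⟨κ, hκ, hκ₀⟩ := exists_conj_of_forall_sameCycle (f := W)
    (Y := S.Corner) (g := S.turn.subtypePerm hturn) (y₀ := ⟨r, hr⟩)
    hW (fun y => Perm.sameCycle_subtypePerm.2 (S.bottomLeft_eq_iff.1 (hr.trans y.2.symm)))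
    (hC.trans S.card_corner.symm)
  -- First return of the horizontal flow on `B` to the corners gives `len` and `perm`; first return
  -- of the vertical flow to `B` gives `roof` and `gluing`.
  let B : Type := {q // S.BottomInSaddleGraph q}
  obtain ⟨len, perm, e₁, h₁, h₁'⟩ := Tower.exists_equiv (Y := B)
    (S.right.subtypePerm S.bottomInSaddleGraph_right_iff)
    (κ := fun c => ⟨(κ c).1, S.bottomInSaddleGraph_of_corner (κ c).2⟩)
    (fun c c' h => κ.injective (Subtype.ext (Subtype.mk.inj h)))
    (by
      rintro ⟨q, p, hqp, hp⟩
      obtain ⟨c, hc⟩ := κ.surjective ⟨p, hp⟩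
      refine ⟨c, Perm.sameCycle_subtypePerm.2 ?_⟩
      rw [hc]
      exact hqp.symm)
  obtain ⟨roof, gluing, e₂, h₂, h₂'⟩ := Tower.exists_equiv S.up (κ := fun y => (e₁ y).1)
    (fun y y' h => e₁.injective (Subtype.ext h))
    (by
      intro q
      obtain ⟨b, hb, hbq⟩ := S.exists_sameCycle_up q
      obtain ⟨y, hy⟩ := e₁.surjective ⟨b, hb⟩
      exact ⟨y, by rw [hy]; exact hbq⟩)
  have hright : ∀ y, (e₁ (Tower.shift len perm y)).1 = S.right (e₁ y).1 := fun y => by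
    rw [h₁']; rfl
  have hB : ∀ q, S.BottomInSaddleGraph (e₂ q) ↔ q.lvl = 0 := by
    intro q
    constructor
    · intro h
      obtain ⟨y, hy⟩ := e₁.surjective ⟨_, h⟩
      rw [← e₂.injective ((h₂ y).trans (congr_arg Subtype.val hy))]
      rfl
    · intro h
      rw [Tower.eq_base h, h₂]
      exact (e₁ _).2
  -- `right` preserves the level: if the neighboring column ended earlier, a side off the saddle
  -- graph would continue horizontally into it.
  have hlevel : ∀ p : Tower roof, ∃ h : p.lvl < roof (Tower.shift len perm p.pt),
      S.right (e₂ p) = e₂ ⟨Tower.shift len perm p.pt, p.lvl, h⟩ := by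
    intro p
    induction p using Tower.induction_up with
    | h0 y =>
      refine ⟨PNat.pos _, ?_⟩
      rw [h₂, ← hright]
      exact (h₂ _).symm
    | h1 y s hs ih =>
      obtain ⟨h, ih⟩ := ih
      have h3 : e₂ ⟨y, s + 1, hs⟩ = S.up (e₂ ⟨y, s, Nat.lt_of_succ_lt hs⟩) := by
        rw [← h₂', Tower.shift_of_lt gluing (p := ⟨y, s, Nat.lt_of_succ_lt hs⟩) hs]
      have h4 : ¬ S.BottomInSaddleGraph (e₂ ⟨y, s + 1, hs⟩) := by
        rw [hB]
        exact Nat.succ_ne_zero s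
      have h5 : S.right (e₂ ⟨y, s + 1, hs⟩) =
          e₂ (Tower.shift roof gluing ⟨Tower.shift len perm y, s, h⟩) := by
        rw [h₂', ← ih, h3, S.up_right_of_not]
        rwa [← h3]
      by_cases hlt : s + 1 < roof (Tower.shift len perm y)
      · refine ⟨hlt, ?_⟩
        rw [h5, Tower.shift_of_lt gluing (p := ⟨Tower.shift len perm y, s, h⟩) hlt]
      · rw [Tower.shift_of_not_lt gluing (by exact hlt)] at h5
        rw [← S.bottomInSaddleGraph_right_iff, h5, hB] at h4
        exact absurd rfl h4
  -- Heights do not decrease to the right, and rows are closed cycles, so they are constant.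
  have hle : ∀ y, roof y ≤ roof (Tower.shift len perm y) := fun y => by
    have h := (hlevel (Tower.top roof y)).1
    simp only [Tower.top] at h
    have h0 := (roof y).pos
    exact PNat.coe_le_coe _ _ |>.1 (by omega)
  have hroof : ∀ y, roof (Tower.shift len perm y) = roof y := fun y => by
    refine le_antisymm ?_ (hle y)
    exact ((Perm.sameCycle_apply_left.2 (Perm.SameCycle.refl (Tower.shift len perm) y)).iff_of_closed
      (P := fun z => roof (Tower.shift len perm y) ≤ roof z) fun z hz => hz.trans (hle z)).1 le_rfl
  -- Within a saddle connection the vertex is regular and both shifts agree; at its end `turn` acts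
  -- on corners as `W`.
  have hturn' : ∀ y, S.turn (e₁ (Tower.shift len perm y)).1 =
      (e₁ (Tower.shift len (W * perm) y)).1 := by
    intro y
    by_cases hlt : y.lvl + 1 < len y.pt
    · rw [Tower.shift_of_lt _ hlt, Tower.shift_of_lt _ hlt]
      refine S.turn_eq_self fun h => ?_
      obtain ⟨c, hc⟩ := κ.surjective ⟨_, h⟩
      have h1 := h₁ c
      simp only [hc] at h1
      exact absurd (congr_arg Tower.lvl (e₁.injective h1)) (Nat.succ_ne_zero _).symm
    · rw [Tower.shift_of_not_lt _ hlt, Tower.shift_of_not_lt _ hlt, h₁, h₁, Perm.mul_apply, hκ]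
      rfl
  have hglue : ∀ y, gluing (Tower.shift len perm y) = Tower.shift len (W * perm) (gluing y) := by
    intro y
    apply e₁.injective
    apply Subtype.ext
    -- The gluing relation is `turn_right_up` at the top square over `y`.
    obtain ⟨hlt, htop⟩ := hlevel (Tower.top roof y)
    have h3 : (⟨Tower.shift len perm (Tower.top roof y).pt, (Tower.top roof y).lvl, hlt⟩ :
        Tower roof) = Tower.top roof (Tower.shift len perm y) := by
      refine Tower.ext rfl ?_
      simp only [Tower.top, hroof]
    rw [h3] at htop
    rw [← hturn', hright, ← h₂, ← Tower.shift_top, h₂', ← htop, ← S.turn_right_up, ← h₂',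
      Tower.shift_top, h₂]
  refine ⟨⟨perm, len, roof, gluing, hroof, hglue⟩, e₂, ?_, ?_⟩
  · refine MinimalSurface.IsIso.of_corner (fun q => ?_) h₂' (r := Tower.base _ (Tower.base _ c₀))
      ((CylinderDatum.bottomLeft_surface_iff _ hW hC _).2 ⟨c₀, rfl⟩) ?_
    · exact (hlevel q).2.symm
    · rw [h₂, h₁]
      exact (κ c₀).2
  · change e₂ (Tower.base _ (Tower.base _ c₀)) = r
    rw [h₂, h₁, hκ₀]

theorem Equiv.Perm.sameCycle_iff_of_intertwine {X Y : Type} {f : Perm X} {g : Perm Y} {e : X → Y}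
    (he : Function.Injective e) (h : ∀ x, e (f x) = g (e x)) (x y : X) :
    f.SameCycle x y ↔ g.SameCycle (e x) (e y) := by
  have key := IsCycleLabel.intertwine_zpow h
  constructor
  · rintro ⟨z, rfl⟩
    exact ⟨z, (key z x).symm⟩
  · rintro ⟨z, hz⟩
    exact ⟨z, he ((key z x).trans hz)⟩

/-! ### Ribbon graphs -/

namespace RibbonGraph

variable {H : Type} (G : RibbonGraph H)

theorem edge_eq_iff {h h' : H} : G.edge h = G.edge h' ↔ h' = h ∨ h' = G.flip h := by
  constructor
  · intro hh
    obtain ⟨z, rfl⟩ : G.flip.SameCycle h h' := Quotient.exact hh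
    induction z with
    | zero => exact Or.inl rfl
    | succ n ih =>
      rw [add_comm, zpow_one_add, Perm.mul_apply]
      rcases ih (Quotient.sound ⟨n, rfl⟩) with h1 | h1 <;> rw [h1]
      · exact Or.inr rfl
      · exact Or.inl (G.flip_flip h)
    | pred n ih =>
      rw [sub_eq_neg_add, zpow_add, zpow_neg_one, Perm.mul_apply, Perm.inv_eq_iff_eq,
        Perm.inv_eq_iff_eq, G.flip_flip]
      rcases ih (Quotient.sound ⟨_, rfl⟩) with h1 | h1 <;> rw [h1]
      · exact Or.inr rfl
      · exact Or.inl rfl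
  · rintro (rfl | rfl)
    · rfl
    · exact Quotient.sound (Perm.sameCycle_apply_right.2 (Perm.SameCycle.refl _ _))

theorem edge_flip (h : H) : G.edge (G.flip h) = G.edge h :=
  (G.edge_eq_iff.2 (Or.inr rfl)).symm

theorem boundary_eq_iff {h h' : H} :
    G.boundary h = G.boundary h' ↔ (G.next * G.flip).SameCycle h h' := Quotient.eq

theorem boundary_next_flip (h : H) : G.boundary (G.next (G.flip h)) = G.boundary h :=
  G.boundary_eq_iff.2
    (Perm.sameCycle_apply_left (f := G.next * G.flip).2 (Perm.SameCycle.refl _ _))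

theorem boundary_next (h : H) : G.boundary (G.next h) = G.boundary (G.flip h) := by
  rw [← G.boundary_next_flip (G.flip h), G.flip_flip]

end RibbonGraph

/-! ### Bicolored one-vertex ribbon graphs. -/

namespace ColoredRibbonGraph

variable {γ k l : ℕ} {H H' : Type} (G : ColoredRibbonGraph γ k l H)

/-- The side `h` belongs to a black boundary component. -/
def IsBlack (h : H) : Prop := (G.label (G.boundary h)).isLeft = true

theorem isBlack_flip_iff (h : H) : G.IsBlack (G.flip h) ↔ ¬ G.IsBlack h := by
  have := G.opposite h
  unfold IsBlack
  cases h1 : (G.label (G.boundary h)).isLeft <;>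
    cases h2 : (G.label (G.boundary (G.flip h))).isLeft <;> simp_all

/-- Colors alternate around the vertex, so `next * next` acts on the black sides; up to inversion it
plays the role of `W`. -/
theorem isBlack_next_iff (h : H) : G.IsBlack (G.next h) ↔ ¬ G.IsBlack h := by
  rw [← isBlack_flip_iff, IsBlack, IsBlack, G.boundary_next]

theorem isBlack_next_next_iff (h : H) : G.IsBlack ((G.next * G.next) h) ↔ G.IsBlack h := by
  rw [Perm.mul_apply, isBlack_next_iff, isBlack_next_iff, not_not]

theorem isBlack_next_flip_iff (h : H) : G.IsBlack ((G.next * G.flip) h) ↔ G.IsBlack h := by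
  rw [Perm.mul_apply, isBlack_next_iff, isBlack_flip_iff, not_not]

theorem sameCycle_next (h h' : H) : G.next.SameCycle h h' := by
  have h1 := (Nat.card_eq_one_iff_unique.1 G.one_vertex).1
  exact Quotient.exact (h1.elim (Quotient.mk (Perm.SameCycle.setoid G.next) h)
    (Quotient.mk _ h'))

/-- Every edge has exactly one black side. -/
theorem card_isBlack : Nat.card {h // G.IsBlack h} = Nat.card G.Edge := by
  refine Nat.card_congr (Equiv.ofBijective (fun h => G.edge h.1) ⟨?_, ?_⟩)
  · rintro ⟨h, hh⟩ ⟨h', hh'⟩ he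
    rcases G.edge_eq_iff.1 he with h1 | h1
    · exact Subtype.ext h1.symm
    · simp only at h1
      rw [h1, isBlack_flip_iff] at hh'
      exact absurd hh hh'
  · rintro ⟨h⟩
    by_cases hh : G.IsBlack h
    · exact ⟨⟨h, hh⟩, rfl⟩
    · exact ⟨⟨G.flip h, (G.isBlack_flip_iff h).2 hh⟩, G.edge_flip h⟩

theorem card_edge : (Nat.card G.Edge : ℤ) = k + l - 1 + 2 * γ := by
  have h1 := G.genus
  have h2 : Nat.card G.Boundary = k + l := by
    rw [Nat.card_congr G.label, Nat.card_sum, Nat.card_fin, Nat.card_fin]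
  rw [RibbonGraph.HasGenus, G.one_vertex, h2] at h1
  push_cast at h1
  linarith

/-- The square of the rotation around the vertex acts transitively on the black sides. -/
theorem sameCycle_next_next {h h' : H} (hh : G.IsBlack h) (hh' : G.IsBlack h') :
    (G.next * G.next).SameCycle h h' := by
  obtain ⟨z, hz⟩ := G.sameCycle_next h h'
  have key : ∀ z : ℤ, G.IsBlack ((G.next ^ z) h) ↔ Even z := fun z => by
    induction z with
    | zero => simpa using hh
    | succ n ih => rw [add_comm, zpow_one_add, Perm.mul_apply, isBlack_next_iff, ih, add_comm,
        Int.even_add_one]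
    | pred n ih =>
      have h1 : G.next ((G.next ^ (-(n : ℤ) - 1)) h) = (G.next ^ (-(n : ℤ))) h := by
        rw [← Perm.mul_apply, ← zpow_one_add, add_sub_cancel]
      rw [← not_iff_not, ← isBlack_next_iff, h1, ih, Int.even_sub_one, not_not]
  obtain ⟨m, rfl⟩ := (key z).1 (by rwa [hz])
  refine ⟨m, ?_⟩
  rw [← hz, zpow_add, ← (Commute.refl G.next).mul_zpow]

theorem exists_isIso (e : H ≃ H') : ∃ G' : ColoredRibbonGraph γ k l H', G.IsIso G' e := by
  let next := e.permCongr G.next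
  let flip := e.permCongr G.flip
  have hn : ∀ h, e (G.next h) = next (e h) := fun h => by simp [next, Equiv.permCongr_apply]
  have hf : ∀ h, e (G.flip h) = flip (e h) := fun h => by simp [flip, Equiv.permCongr_apply]
  have hb : ∀ h, e ((G.next * G.flip) h) = (next * flip) (e h) := fun h => by
    rw [Perm.mul_apply, Perm.mul_apply, hn, hf]
  have hnc : ∀ h h', G.next.SameCycle h h' ↔ next.SameCycle (e h) (e h') :=
    Perm.sameCycle_iff_of_intertwine e.injective hn
  let φ : G.Boundary ≃ Quotient (Perm.SameCycle.setoid (next * flip)) :=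
    Quotient.congr e (Perm.sameCycle_iff_of_intertwine e.injective hb)
  let ν : G.Vertex ≃ Quotient (Perm.SameCycle.setoid next) := Quotient.congr e hnc
  let ε : G.Edge ≃ Quotient (Perm.SameCycle.setoid flip) :=
    Quotient.congr e (Perm.sameCycle_iff_of_intertwine e.injective hf)
  have hne : Nonempty H' := G.nonempty.map e
  let R : RibbonGraph H' :=
    { next := next
      flip := flip
      flip_flip := fun h => by
        obtain ⟨h, rfl⟩ := e.surjective h
        rw [← hf, ← hf, G.flip_flip]
      flip_ne := fun h => by
        obtain ⟨h, rfl⟩ := e.surjective h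
        rw [← hf]
        exact fun hh => G.flip_ne h (e.injective hh)
      nonempty := hne
      connected := ⟨fun x y => by
        obtain ⟨h, rfl⟩ := e.surjective x
        obtain ⟨h', rfl⟩ := e.surjective y
        obtain ⟨z, hz⟩ := (hnc h h').1 (G.sameCycle_next h h')
        exact ⟨⟨next, Subgroup.subset_closure (by simp)⟩ ^ z, hz⟩⟩ }
  refine ⟨{ R with
    one_vertex := (Nat.card_congr ν).symm.trans G.one_vertex
    label := φ.symm.trans G.label
    genus := ?_
    opposite := ?_ }, hn, hf, ?_⟩
  · have h1 := G.genus
    unfold RibbonGraph.HasGenus at h1 ⊢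
    rw [← h1, Nat.card_congr ν, Nat.card_congr ε, Nat.card_congr φ]
    rfl
  · intro h
    obtain ⟨h, rfl⟩ := e.surjective h
    change (G.label (φ.symm (φ (G.boundary h)))).isLeft ≠
      (G.label (φ.symm (R.boundary (flip (e h))))).isLeft
    rw [← hf]
    change _ ≠ (G.label (φ.symm (φ (G.boundary (G.flip h))))).isLeft
    rw [φ.symm_apply_apply, φ.symm_apply_apply]
    exact G.opposite h
  · intro h
    change G.label (φ.symm (φ (G.boundary h))) = _
    rw [φ.symm_apply_apply]

namespace IsIso

variable {G} {G' : ColoredRibbonGraph γ k l H'} {e : H ≃ H'}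

theorem symm (h : G.IsIso G' e) : G'.IsIso G e.symm := by
  obtain ⟨h1, h2, h3⟩ := h
  refine ⟨fun q => ?_, fun q => ?_, fun q => ?_⟩
  · rw [Equiv.symm_apply_eq, h1, Equiv.apply_symm_apply]
  · rw [Equiv.symm_apply_eq, h2, Equiv.apply_symm_apply]
  · rw [← h3, Equiv.apply_symm_apply]

theorem trans {H'' : Type} {G'' : ColoredRibbonGraph γ k l H''} {e' : H' ≃ H''}
    (h : G.IsIso G' e) (h' : G'.IsIso G'' e') : G.IsIso G'' (e.trans e') := by
  obtain ⟨h1, h2, h3⟩ := h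
  obtain ⟨k1, k2, k3⟩ := h'
  exact ⟨fun q => by simp [h1, k1], fun q => by simp [h2, k2], fun q => by rw [← h3, ← k3]; rfl⟩

end IsIso

end ColoredRibbonGraph

theorem IsCycleLabel.sumCongr {X Y ι κ : Type} {f : Perm X} {g : Perm Y} {a : X → ι} {b : Y → κ}
    (ha : IsCycleLabel f a) (hb : IsCycleLabel g b) :
    IsCycleLabel (Perm.sumCongr f g) (Sum.map a b) := by
  have hl : ∀ x, Sum.inl (f x) = Perm.sumCongr f g (Sum.inl x) := fun _ => rfl
  have hr : ∀ y, Sum.inr (g y) = Perm.sumCongr f g (Sum.inr y) := fun _ => rfl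
  have hlz := IsCycleLabel.intertwine_zpow hl
  have hrz := IsCycleLabel.intertwine_zpow hr
  refine ⟨Sum.map_surjective.2 ⟨ha.1, hb.1⟩, ?_⟩
  rintro (x | x) (y | y)
  · rw [Sum.map_inl, Sum.map_inl, Sum.inl_injective.eq_iff, ha.2]
    exact Perm.sameCycle_iff_of_intertwine Sum.inl_injective hl x y
  · simp only [Sum.map_inl, Sum.map_inr, reduceCtorEq, false_iff]
    rintro ⟨z, hz⟩
    rw [← hlz] at hz
    exact Sum.inl_ne_inr hz
  · simp only [Sum.map_inl, Sum.map_inr, reduceCtorEq, false_iff]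
    rintro ⟨z, hz⟩
    rw [← hrz] at hz
    exact Sum.inr_ne_inl hz
  · rw [Sum.map_inr, Sum.map_inr, Sum.inr_injective.eq_iff, hb.2]
    exact Perm.sameCycle_iff_of_intertwine Sum.inr_injective hr x y

/-! ### Rooted ribbon graphs -/

/-- A permutation `perm` with labels of the cycles of `perm` and of `W * perm`. -/
@[ext]
structure LabeledPerm {C : Type} (W : Perm C) (k l : ℕ) : Type where
  /-- the permutation -/
  perm : Perm C
  /-- the labels of the cycles of the permutation -/
  black : C → Fin k
  /-- the labels of the cycles of the product with `W` -/
  white : C → Fin l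
  isCycleLabel_black : IsCycleLabel perm black
  isCycleLabel_white : IsCycleLabel (W * perm) white

namespace LabeledPerm

variable {C : Type} {W : Perm C} {k l γ : ℕ} (P : LabeledPerm W k l)

instance [Finite C] : Finite (LabeledPerm W k l) :=
  Finite.of_injective
    (fun P : LabeledPerm W k l => ((P.perm, P.black, P.white) : Perm C × (C → Fin k) × (C → Fin l)))
    fun P P' h => by
      simp only [Prod.mk.injEq] at h
      exact LabeledPerm.ext h.1 h.2.1 h.2.2

/-- Following the sides of edges along boundary components. -/
def face : Perm (C ⊕ C) := Perm.sumCongr P.perm (W * P.perm)⁻¹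

theorem isCycleLabel_face : IsCycleLabel P.face (Sum.map P.black P.white) :=
  P.isCycleLabel_black.sumCongr P.isCycleLabel_white.inv

/-- The rotation around the vertex. -/
def next : Perm (C ⊕ C) := P.face * sumComm C C

theorem next_inl (c : C) : P.next (Sum.inl c) = Sum.inr ((W * P.perm)⁻¹ c) := rfl

theorem next_inr (c : C) : P.next (Sum.inr c) = Sum.inl (P.perm c) := rfl

/-- The product `perm * (W * perm)⁻¹` is `W⁻¹`: the rotation around the vertex does not depend on
`perm`, and the faces carry all the information. -/
theorem next_next_inl (c : C) : P.next (P.next (Sum.inl c)) = Sum.inl (W⁻¹ c) := by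
  rw [next_inl, next_inr]
  simp [mul_inv_rev]

theorem sameCycle_next {c₀ : C} (hW : ∀ c, W.SameCycle c₀ c) (h h' : C ⊕ C) : P.next.SameCycle h h' := by
  have h1 : ∀ c, P.next.SameCycle (Sum.inl c₀) (Sum.inl c) := fun c => by
    obtain ⟨z, hz⟩ := Perm.sameCycle_inv.2 (hW c)
    have h2 := IsCycleLabel.intertwine_zpow (f := W⁻¹) (g := P.next * P.next) (e := Sum.inl)
      (fun c => (P.next_next_inl c).symm) z c₀
    rw [← hz, h2, ← sq, ← zpow_natCast, ← zpow_mul]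
    exact ⟨_, rfl⟩
  have h2 : ∀ h, P.next.SameCycle (Sum.inl c₀) h := by
    rintro (c | c)
    · exact h1 c
    · rw [← Perm.sameCycle_apply_right, next_inr]
      exact h1 _
  exact (h2 h).symm.trans (h2 h')

variable {c₀ : C} (hW : ∀ c, W.SameCycle c₀ c)

/-- The one-vertex ribbon graph with the black sides `Sum.inl c` and the white sides
`Sum.inr c`. -/
def ribbonGraph : RibbonGraph (C ⊕ C) where
  next := P.next
  flip := sumComm C C
  flip_flip := by rintro (c | c) <;> rfl
  flip_ne := by rintro (c | c) <;> simp
  nonempty := ⟨Sum.inl c₀⟩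
  connected := ⟨fun x y => by
    obtain ⟨z, hz⟩ := P.sameCycle_next hW x y
    exact ⟨⟨P.next, Subgroup.subset_closure (by simp)⟩ ^ z, hz⟩⟩

theorem next_mul_flip : (P.ribbonGraph hW).next * (P.ribbonGraph hW).flip = P.face := by
  ext (c | c) <;> rfl

theorem isCycleLabel_boundary :
    IsCycleLabel ((P.ribbonGraph hW).next * (P.ribbonGraph hW).flip)
      (Sum.map P.black P.white) := by
  rw [next_mul_flip]
  exact P.isCycleLabel_face

theorem card_edge : Nat.card (P.ribbonGraph hW).Edge = Nat.card C := by
  refine (Nat.card_congr (Equiv.ofBijective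
    (fun c => (P.ribbonGraph hW).edge (Sum.inl c)) ⟨fun c c' h => ?_, ?_⟩)).symm
  · rcases (RibbonGraph.edge_eq_iff _).1 h with h | h
    · exact (Sum.inl_injective h).symm
    · exact absurd h Sum.inl_ne_inr
  · rintro ⟨c | c⟩
    · exact ⟨c, rfl⟩
    · exact ⟨c, ((P.ribbonGraph hW).edge_flip (Sum.inr c))⟩

variable (hC : (Nat.card C : ℤ) = k + l - 1 + 2 * γ)

/-- The colored ribbon graph with the given labels. -/
noncomputable def coloredRibbonGraph : ColoredRibbonGraph γ k l (C ⊕ C) where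
  toRibbonGraph := P.ribbonGraph hW
  one_vertex := Nat.card_eq_one_iff_unique.2
    ⟨⟨by rintro ⟨x⟩ ⟨y⟩; exact Quotient.sound (P.sameCycle_next hW x y)⟩,
      ⟨Quotient.mk _ (Sum.inl c₀)⟩⟩
  label := IsCycleLabel.equivQuotient _ _ ⟨_, P.isCycleLabel_boundary hW⟩
  genus := by
    have h1 : Nat.card (P.ribbonGraph hW).Vertex = 1 := Nat.card_eq_one_iff_unique.2
      ⟨⟨by rintro ⟨x⟩ ⟨y⟩; exact Quotient.sound (P.sameCycle_next hW x y)⟩,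
        ⟨Quotient.mk _ (Sum.inl c₀)⟩⟩
    have h2 : Nat.card (P.ribbonGraph hW).Boundary = k + l := by
      refine (Nat.card_congr
        (IsCycleLabel.equivQuotient _ _ ⟨_, P.isCycleLabel_boundary hW⟩)).trans ?_
      rw [Nat.card_sum, Nat.card_fin, Nat.card_fin]
    rw [RibbonGraph.HasGenus, h1, h2, P.card_edge hW, hC]
    push_cast
    ring
  opposite := by
    rintro (c | c)
    · change (Sum.inl (P.black c) : Fin k ⊕ Fin l).isLeft ≠ (Sum.inr (P.white c)).isLeft
      simp
    · change (Sum.inr (P.white c) : Fin k ⊕ Fin l).isLeft ≠ (Sum.inl (P.black c)).isLeft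
      simp

theorem label_boundary (h : C ⊕ C) :
    (P.coloredRibbonGraph hW hC).label ((P.coloredRibbonGraph hW hC).boundary h) =
      Sum.map P.black P.white h := rfl

/-- A rooted ribbon graph determines the permutation and the labels, and has no nontrivial
automorphisms. -/
theorem eq_of_isIso {P P' : LabeledPerm W k l} {e : C ⊕ C ≃ C ⊕ C}
    (h : (P.coloredRibbonGraph hW hC).IsIso (P'.coloredRibbonGraph hW hC) e)
    (h₀ : e (Sum.inl c₀) = Sum.inl c₀) : P = P' ∧ e = Equiv.refl _ := by
  obtain ⟨hn, hf, hl⟩ := h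
  change ∀ x, e (P.next x) = P'.next (e x) at hn
  change ∀ x, e (sumComm C C x) = sumComm C C (e x) at hf
  change ∀ x, Sum.map P'.black P'.white (e x) = Sum.map P.black P.white x at hl
  have hinl : ∀ c, e (Sum.inl c) = Sum.inl c := by
    intro c
    obtain ⟨z, rfl⟩ := Perm.sameCycle_inv.2 (hW c)
    have h2 := fun P : LabeledPerm W k l => IsCycleLabel.intertwine_zpow (f := W⁻¹)
      (g := P.next * P.next) (e := Sum.inl) (fun c => (P.next_next_inl c).symm) z c₀
    have h3 := IsCycleLabel.intertwine_zpow (f := P.next * P.next) (g := P'.next * P'.next)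
      (e := e) (fun x => by rw [Perm.mul_apply, Perm.mul_apply, hn, hn]) z (Sum.inl c₀)
    rw [h₀, ← h2 P'] at h3
    exact (congr_arg e (h2 P)).trans h3
  have hinr : ∀ c, e (Sum.inr c) = Sum.inr c := fun c => by
    have h1 := hf (Sum.inl c)
    rw [hinl] at h1
    exact h1
  refine ⟨?_, ?_⟩
  · ext c
    · have h1 := hn (Sum.inr c)
      rw [hinr, next_inr, next_inr, hinl] at h1
      exact Sum.inl_injective h1
    · have h1 := hl (Sum.inl c)
      rw [hinl] at h1
      exact congr_arg Fin.val (Sum.inl_injective h1).symm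
    · have h1 := hl (Sum.inr c)
      rw [hinr] at h1
      exact congr_arg Fin.val (Sum.inr_injective h1).symm
  · ext (c | c)
    exacts [hinl c, hinr c]

/-- Every ribbon graph with a chosen black side is of this form. -/
theorem exists_isIso [Finite C] {H : Type} [Finite H] (G : ColoredRibbonGraph γ k l H) {r : H}
    (hr : G.IsBlack r) : ∃ (P : LabeledPerm W k l) (e : C ⊕ C ≃ H),
      (P.coloredRibbonGraph hW hC).IsIso G e ∧ e (Sum.inl c₀) = r := by
  -- Number the black sides by `C`, following `next * next` from the root; Euler's formula gives the
  -- right number of them.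
  obtain ⟨κ, hκ, hκ₀⟩ := exists_conj_of_forall_sameCycle (f := W⁻¹) (x₀ := c₀)
    (Y := {h // G.IsBlack h}) (g := (G.next * G.next).subtypePerm G.isBlack_next_next_iff)
    (y₀ := ⟨r, hr⟩) (fun c => Perm.sameCycle_inv.2 (hW c))
    (fun y => Perm.sameCycle_subtypePerm.2 (G.sameCycle_next_next hr y.2))
    (by rw [G.card_isBlack]; exact_mod_cast hC.trans G.card_edge.symm)
  have hκ' : ∀ c, (κ (W⁻¹ c)).1 = G.next (G.next (κ c).1) := fun c =>
    congr_arg Subtype.val (hκ c)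
  let perm : Perm C := κ.symm.permCongr ((G.next * G.flip).subtypePerm G.isBlack_next_flip_iff)
  have hperm' : ∀ c, κ (perm c) =
      (G.next * G.flip).subtypePerm G.isBlack_next_flip_iff (κ c) := fun c => by
    simp only [perm, Equiv.permCongr_apply, Equiv.symm_symm, Equiv.apply_symm_apply]
  have hperm : ∀ c, (κ (perm c)).1 = G.next (G.flip (κ c).1) := fun c =>
    congr_arg Subtype.val (hperm' c)
  -- With `c = (W * perm) d`, applying `next` sends both sides to the black side numbered `perm d`.
  have hwhite' : ∀ c, G.flip (κ ((W * perm)⁻¹ c)).1 = G.next (κ c).1 := by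
    intro c
    obtain ⟨d, rfl⟩ := (W * perm).surjective c
    apply G.next.injective
    rw [← hκ', Perm.inv_def, symm_apply_apply, ← hperm, Perm.mul_apply, Perm.inv_def,
      symm_apply_apply]
  have hwhite : ∀ c, G.flip (κ ((W * perm)⁻¹ c)).1 = (G.next * G.flip) (G.flip (κ c).1) := by
    intro c
    rw [hwhite', Perm.mul_apply, G.flip_flip]
  have hb : ∀ c, ∃ i, G.label (G.boundary (κ c).1) = Sum.inl i := fun c =>
    Sum.isLeft_iff.1 (κ c).2
  have hw : ∀ c, ∃ i, G.label (G.boundary (G.flip (κ c).1)) = Sum.inr i := fun c => by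
    have h1 := (G.isBlack_flip_iff (κ c).1).not.2 (not_not.2 (κ c).2)
    rw [ColoredRibbonGraph.IsBlack, Bool.not_eq_true, Sum.isLeft_eq_false] at h1
    exact Sum.isRight_iff.1 h1
  choose black hblack using hb
  choose white hwhite'' using hw
  have hsurj : ∀ h, (∃ c, (κ c).1 = h) ∨ ∃ c, G.flip (κ c).1 = h := by
    intro h
    by_cases hh : G.IsBlack h
    · obtain ⟨c, hc⟩ := κ.surjective ⟨h, hh⟩
      exact Or.inl ⟨c, by rw [hc]⟩
    · obtain ⟨c, hc⟩ := κ.surjective ⟨G.flip h, (G.isBlack_flip_iff h).2 hh⟩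
      exact Or.inr ⟨c, by rw [hc, G.flip_flip]⟩
  have hinj : Function.Injective fun c => (κ c).1 := Subtype.val_injective.comp κ.injective
  let P : LabeledPerm W k l :=
    { perm := perm
      black := black
      white := white
      isCycleLabel_black := by
        refine ⟨fun i => ?_, fun c c' => ?_⟩
        · obtain ⟨h, hh⟩ : ∃ h, G.boundary h = G.label.symm (Sum.inl i) := Quotient.exists_rep _
          rw [G.label.eq_symm_apply] at hh
          rcases hsurj h with ⟨c, rfl⟩ | ⟨c, rfl⟩
          · exact ⟨c, Sum.inl_injective ((hblack c).symm.trans hh)⟩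
          · exact absurd ((hwhite'' c).symm.trans hh) Sum.inr_ne_inl
        · rw [← Sum.inl_injective.eq_iff (a := black c), ← hblack, ← hblack,
            G.label.injective.eq_iff, G.boundary_eq_iff]
          exact (Perm.sameCycle_iff_of_intertwine hinj hperm c c').symm
      isCycleLabel_white := by
        refine ⟨fun i => ?_, fun c c' => ?_⟩
        · obtain ⟨h, hh⟩ : ∃ h, G.boundary h = G.label.symm (Sum.inr i) := Quotient.exists_rep _
          rw [G.label.eq_symm_apply] at hh
          rcases hsurj h with ⟨c, rfl⟩ | ⟨c, rfl⟩
          · exact absurd ((hblack c).symm.trans hh) Sum.inl_ne_inr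
          · exact ⟨c, Sum.inr_injective ((hwhite'' c).symm.trans hh)⟩
        · rw [← Sum.inr_injective.eq_iff (a := white c), ← hwhite'', ← hwhite'',
            G.label.injective.eq_iff, G.boundary_eq_iff, ← Perm.sameCycle_inv (f := W * perm)]
          exact (Perm.sameCycle_iff_of_intertwine (f := (W * perm)⁻¹)
            (e := fun c => G.flip (κ c).1) (G.flip.injective.comp hinj) hwhite c c').symm }
  let e : C ⊕ C → H := Sum.elim (fun c => (κ c).1) fun c => G.flip (κ c).1
  have he : Function.Bijective e := by
    constructor
    · have hne : ∀ c c', (κ c).1 ≠ G.flip (κ c').1 := fun c c' h =>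
        (G.isBlack_flip_iff (κ c').1).1 (h ▸ (κ c).2) (κ c').2
      rintro (c | c) (c' | c') h
      · exact congr_arg _ (hinj h)
      · exact absurd h (hne c c')
      · exact absurd h.symm (hne c' c)
      · exact congr_arg _ (hinj (G.flip.injective h))
    · intro h
      rcases hsurj h with ⟨c, hc⟩ | ⟨c, hc⟩
      exacts [⟨Sum.inl c, hc⟩, ⟨Sum.inr c, hc⟩]
  refine ⟨P, Equiv.ofBijective e he, ⟨?_, ?_, ?_⟩, congr_arg Subtype.val hκ₀⟩
  · rintro (c | c)
    · exact hwhite' c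
    · exact hperm c
  · rintro (c | c)
    · rfl
    · exact (G.flip_flip _).symm
  · rintro (c | c)
    · exact hblack c
    · exact hwhite'' c

end LabeledPerm

/-! ### Weighted counts as counts of rooted ribbon graphs. -/

namespace LabeledPerm

variable {C : Type} {W : Perm C} {k l γ : ℕ} {c₀ : C} (hW : ∀ c, W.SameCycle c₀ c)
  (hC : (Nat.card C : ℤ) = k + l - 1 + 2 * γ)

/-- The rooted versions of a ribbon graph, up to isomorphism, are the orbits of its automorphism
group on the black sides. -/
theorem card_isIso_mul_card_aut [Finite C] {H : Type} [Finite H]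
    (G : ColoredRibbonGraph γ k l H) :
    Nat.card {P : LabeledPerm W k l // ∃ e, (P.coloredRibbonGraph hW hC).IsIso G e} *
      Nat.card G.Aut = Nat.card C := by
  -- Double counting of `T`: the image of the root identifies it with the black sides of `G`, and a
  -- reference isomorphism `e₀ P` for each `P` identifies it with rooted versions times
  -- automorphisms.
  let T : Type := Σ P : LabeledPerm W k l,
    {e : C ⊕ C ≃ H // (P.coloredRibbonGraph hW hC).IsIso G e}
  have hblack : ∀ x : T, G.IsBlack (x.2.1 (Sum.inl c₀)) := by
    rintro ⟨P, e, h1, h2, h3⟩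
    simp only [ColoredRibbonGraph.IsBlack, h3, label_boundary]
    rfl
  have hT : Nat.card T = Nat.card C := by
    have h1 : Nat.card C = Nat.card {h // G.IsBlack h} := by
      rw [G.card_isBlack]
      exact_mod_cast hC.trans G.card_edge.symm
    rw [h1]
    refine Nat.card_congr (Equiv.ofBijective (fun x => ⟨x.2.1 (Sum.inl c₀), hblack x⟩) ⟨?_, ?_⟩)
    · rintro ⟨P, e, h⟩ ⟨P', e', h'⟩ hx
      simp only [Subtype.mk.injEq] at hx
      obtain ⟨rfl, h2⟩ := eq_of_isIso hW hC (h.trans h'.symm) (by simp [hx])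
      obtain rfl : e = e' := by
        ext x
        have h3 := congr_arg e' (Equiv.ext_iff.1 h2 x)
        simpa using h3
      rfl
    · rintro ⟨r, hr⟩
      obtain ⟨P, e, h, h0⟩ := exists_isIso hW hC G hr
      exact ⟨⟨P, e, h⟩, Subtype.ext h0⟩
  rw [← hT, ← Nat.card_prod]
  choose e₀ he₀ using
    fun P : {P : LabeledPerm W k l // ∃ e, (P.coloredRibbonGraph hW hC).IsIso G e} => P.2
  refine Nat.card_congr
    { toFun := fun x => ⟨x.1.1, (e₀ x.1).trans x.2.1, (he₀ x.1).trans x.2.2⟩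
      invFun := fun y => (⟨y.1, y.2.1, y.2.2⟩,
        ⟨(e₀ ⟨y.1, y.2.1, y.2.2⟩).symm.trans y.2.1, (he₀ ⟨y.1, y.2.1, y.2.2⟩).symm.trans y.2.2⟩)
      left_inv := fun x => ?_
      right_inv := fun y => ?_ }
  · refine Prod.ext rfl (Subtype.ext ?_)
    ext h
    simp
  · refine Sigma.ext rfl (heq_of_eq (Subtype.ext ?_))
    ext h
    simp

variable [Fintype C]

/-- The number of integral metrics with given perimeters. -/
noncomputable def metricCount (P : LabeledPerm W k l) (L : Fin k → ℕ) (L' : Fin l → ℕ) : ℕ :=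
  Nat.card {ℓ : C → ℕ+ // (∀ i, ∑ c with P.black c = i, (ℓ c : ℕ) = L i) ∧
    ∀ j, ∑ c with P.white c = j, (ℓ c : ℕ) = L' j}

variable {hW hC}

theorem metricCount_eq {H : Type} [Fintype H] {G : ColoredRibbonGraph γ k l H}
    {P : LabeledPerm W k l} {e : C ⊕ C ≃ H} (he : (P.coloredRibbonGraph hW hC).IsIso G e)
    (L : Fin k → ℕ) (L' : Fin l → ℕ) :
    G.metricCount (fun i => (L i : ℤ)) (fun j => (L' j : ℤ)) = P.metricCount L L' := by
  classical
  obtain ⟨-, hf, hl⟩ := he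
  have hflip : ∀ c, e (Sum.inr c) = G.flip (e (Sum.inl c)) := fun c => hf (Sum.inl c)
  have hη : Function.Bijective fun c => G.edge (e (Sum.inl c)) := by
    constructor
    · intro c c' h
      rcases G.edge_eq_iff.1 h with h | h
      · exact (Sum.inl_injective (e.injective h)).symm
      · rw [← hflip] at h
        exact absurd (e.injective h) Sum.inl_ne_inr
    · rintro ⟨h⟩
      obtain ⟨c | c, rfl⟩ := e.surjective h
      · exact ⟨c, rfl⟩
      · rw [hflip]
        exact ⟨c, (G.edge_flip _).symm⟩
  let η : C ≃ G.Edge := Equiv.ofBijective _ hη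
  have hηr : ∀ c, G.edge (e (Sum.inr c)) = η c := fun c => by rw [hflip, G.edge_flip]; rfl
  have hb : ∀ x y, G.boundary (e x) = G.label.symm y ↔ Sum.map P.black P.white x = y :=
    fun x y => by rw [G.label.eq_symm_apply, hl, label_boundary]
  have hpl : ∀ (f : G.Edge → ℤ) i, G.perimeter f (G.label.symm (Sum.inl i)) =
      ∑ c with P.black c = i, f (η c) := fun f i => by
    rw [RibbonGraph.perimeter, Finset.sum_filter, ← Equiv.sum_comp e, Fintype.sum_sum_type]
    simp only [hb, Sum.map_inl, Sum.map_inr, Sum.inl.injEq, reduceCtorEq, if_false,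
      Finset.sum_const_zero, add_zero]
    rw [Finset.sum_filter]
    rfl
  have hpr : ∀ (f : G.Edge → ℤ) j, G.perimeter f (G.label.symm (Sum.inr j)) =
      ∑ c with P.white c = j, f (η c) := fun f j => by
    rw [RibbonGraph.perimeter, Finset.sum_filter, ← Equiv.sum_comp e, Fintype.sum_sum_type]
    simp only [hb, Sum.map_inl, Sum.map_inr, Sum.inr.injEq, reduceCtorEq, if_false,
      Finset.sum_const_zero, zero_add, hηr]
    rw [Finset.sum_filter]
  refine Nat.card_congr
    { toFun := fun f => ⟨fun c => ⟨(f.1 (η c)).toNat, Int.pos_iff_toNat_pos.1 (f.2.1 _)⟩, ?_, ?_⟩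
      invFun := fun ℓ => ⟨fun ε => ((ℓ.1 (η.symm ε) : ℕ) : ℤ), ?_, ?_, ?_⟩
      left_inv := fun f => ?_
      right_inv := fun ℓ => ?_ }
  · intro i
    have h1 : _ = (L i : ℤ) := f.2.2.1 i
    rw [hpl] at h1
    have h2 : ∑ c with P.black c = i, (f.1 (η c)).toNat = L i := by
      rw [← Nat.cast_inj (R := ℤ), ← h1, Nat.cast_sum]
      exact Finset.sum_congr rfl fun c _ => Int.toNat_of_nonneg (f.2.1 _).le
    exact h2
  · intro j
    have h1 : _ = (L' j : ℤ) := f.2.2.2 j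
    rw [hpr] at h1
    have h2 : ∑ c with P.white c = j, (f.1 (η c)).toNat = L' j := by
      rw [← Nat.cast_inj (R := ℤ), ← h1, Nat.cast_sum]
      exact Finset.sum_congr rfl fun c _ => Int.toNat_of_nonneg (f.2.1 _).le
    exact h2
  · exact fun ε => Int.natCast_pos.2 (PNat.pos _)
  · intro i
    simp only [hpl, ← ℓ.2.1 i, Nat.cast_sum, symm_apply_apply]
  · intro j
    simp only [hpr, ← ℓ.2.2 j, Nat.cast_sum, symm_apply_apply]
  · refine Subtype.ext (funext fun ε => ?_)
    simp only [PNat.mk_coe, η.apply_symm_apply]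
    exact Int.toNat_of_nonneg (f.2.1 _).le
  · refine Subtype.ext (funext fun c => PNat.eq ?_)
    simp

/-- The weighted count of metric ribbon graphs is a count of rooted metric ribbon graphs. -/
theorem card_mul_weightedCount [Fintype (LabeledPerm W k l)] (hW : ∀ c, W.SameCycle c₀ c)
    (hC : (Nat.card C : ℤ) = k + l - 1 + 2 * γ) (L : Fin k → ℕ) (L' : Fin l → ℕ) :
    (Nat.card C : ℚ) * weightedCount γ k l (fun i => (L i : ℤ)) (fun j => (L' j : ℤ)) =
      ∑ P : LabeledPerm W k l, (P.metricCount L L' : ℚ) := by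
  classical
  let m := Nat.card (C ⊕ C)
  choose G₀ hG₀ using fun P : LabeledPerm W k l =>
    (P.coloredRibbonGraph hW hC).exists_isIso (Finite.equivFin (C ⊕ C))
  let cls : LabeledPerm W k l → RibbonClasses γ k l := fun P =>
    Quotient.mk (ribbonSetoid γ k l) ⟨m, G₀ P⟩
  have hcls : ∀ P c, cls P = c ↔
      ∃ e, (P.coloredRibbonGraph hW hC).IsIso (Quotient.out c).2 e := by
    intro P c
    constructor
    · rintro rfl
      obtain ⟨e, he⟩ : (ribbonSetoid γ k l).r (Quotient.out (cls P)) ⟨m, G₀ P⟩ :=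
        Quotient.exact (Quotient.out_eq (cls P))
      have he' : (Quotient.out (cls P)).2.IsIso (G₀ P) e := he
      exact ⟨_, (hG₀ P).trans he'.symm⟩
    · rintro ⟨e, he⟩
      rw [← Quotient.out_eq c]
      exact Quotient.sound ⟨_, (hG₀ P).symm.trans he⟩
  have hsurj : Function.Surjective cls := by
    intro c
    have h1 : Nat.card {P : LabeledPerm W k l // ∃ e,
        (P.coloredRibbonGraph hW hC).IsIso (Quotient.out c).2 e} ≠ 0 := by
      intro h
      have h2 := card_isIso_mul_card_aut hW hC (Quotient.out c).2
      rw [h, zero_mul] at h2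
      have : Nonempty C := ⟨c₀⟩
      exact Nat.card_pos.ne h2
    obtain ⟨P, hP⟩ := (Nat.card_ne_zero.1 h1).1
    exact ⟨P, (hcls P c).2 hP⟩
  -- Every class has a rooted version, so there are finitely many, and the `finsum` is an honest
  -- sum.
  have : Finite (RibbonClasses γ k l) := Finite.of_surjective cls hsurj
  have := Fintype.ofFinite (RibbonClasses γ k l)
  rw [weightedCount, finsum_eq_sum_of_fintype, Finset.mul_sum, ← Finset.sum_fiberwise _ cls]
  refine Finset.sum_congr rfl fun c _ => ?_
  have h1 : ∀ P ∈ Finset.univ.filter (fun P => cls P = c), (P.metricCount L L' : ℚ) =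
      ((Quotient.out c).2.metricCount (fun i => (L i : ℤ)) (fun j => (L' j : ℤ)) : ℚ) := by
    intro P hP
    obtain ⟨e, he⟩ := (hcls P c).1 (Finset.mem_filter.1 hP).2
    rw [metricCount_eq he]
  rw [Finset.sum_congr rfl h1, Finset.sum_const, nsmul_eq_mul, ← mul_assoc]
  congr 1
  have h2 := card_isIso_mul_card_aut hW hC (Quotient.out c).2
  have h3 : Nat.card {P : LabeledPerm W k l // ∃ e,
      (P.coloredRibbonGraph hW hC).IsIso (Quotient.out c).2 e} =
      (Finset.univ.filter (fun P => cls P = c)).card := by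
    rw [← Fintype.card_subtype, ← Nat.card_eq_fintype_card]
    exact Nat.card_congr (Equiv.subtypeEquivRight fun P => (hcls P c).symm)
  rw [h3] at h2
  -- The product in `h2` is the positive number `Nat.card C`, so neither factor takes the value `0`.
  have h4 : (Nat.card (Quotient.out c).2.Aut : ℚ) ≠ 0 := by
    intro h
    rw [Nat.cast_eq_zero.1 h, mul_zero] at h2
    have : Nonempty C := ⟨c₀⟩
    exact Nat.card_pos.ne h2
  rw [← h2, Nat.cast_mul]
  field_simp

end LabeledPerm

theorem IsCycleLabel.comp_symm {X Y ι : Type} {f : Perm X} {g : Perm Y} {a : X → ι}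
    (ha : IsCycleLabel f a) {e : X ≃ Y} (he : ∀ x, e (f x) = g (e x)) :
    IsCycleLabel g fun y => a (e.symm y) := by
  refine ⟨ha.1.comp e.symm.surjective, fun x y => ?_⟩
  rw [ha.2, Perm.sameCycle_iff_of_intertwine e.injective he, apply_symm_apply, apply_symm_apply]

/-! ### Numbers of squares in cylinders. -/

namespace Tower

variable {X ι : Type} [Fintype X] [DecidableEq ι]

theorem card_fiber (τ : X → ℕ+) (a : X → ι) (i : ι) :
    Nat.card {p : Tower τ // a p.pt = i} = ∑ x with a x = i, (τ x : ℕ) := by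
  let e : {p : Tower τ // a p.pt = i} ≃ Tower fun x : {x // a x = i} => τ x.1 :=
    { toFun := fun p => ⟨⟨p.1.pt, p.2⟩, p.1.lvl, p.1.lt⟩
      invFun := fun p => ⟨⟨p.pt.1, p.lvl, p.lt⟩, p.pt.2⟩
      left_inv := fun _ => rfl
      right_inv := fun _ => rfl }
  rw [Nat.card_congr e, card_eq, Finset.sum_subtype (p := fun x => a x = i) _ (by simp)]

/-- The number of points of a tower whose height depends on a label of the base point only. -/
theorem card_tower [Fintype ι] (τ : X → ℕ+) (a : X → ι) (h : ι → ℕ) (roof : Tower τ → ℕ+)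
    (hroof : ∀ x, (roof x : ℕ) = h (a x.pt)) :
    Nat.card (Tower roof) = ∑ i, h i * ∑ x with a x = i, (τ x : ℕ) := by
  have := Fintype.ofFinite (Tower τ)
  rw [card_eq, ← Finset.sum_fiberwise _ fun p : Tower τ => a p.pt]
  refine Finset.sum_congr rfl fun i _ => ?_
  have h1 : ∀ p ∈ Finset.univ.filter (fun p : Tower τ => a p.pt = i), (roof p : ℕ) = h i := by
    intro p hp
    rw [hroof, (Finset.mem_filter.1 hp).2]
  rw [Finset.sum_congr rfl h1, Finset.sum_const, smul_eq_mul, mul_comm, ← card_fiber,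
    ← Fintype.card_subtype, Nat.card_eq_fintype_card]

end Tower

/-! ### Forgetting the root and the labels of the cylinders. -/

namespace CylinderDatum

variable {C : Type} {W : Perm C} {c₀ : C} {g n N : ℕ}

/-- The surfaces with `n` cylinders and at most `N` squares. -/
abbrev Bounded (W : Perm C) (n N : ℕ) : Type :=
  {D : CylinderDatum W // Nat.card D.Square ≤ N ∧
    Nat.card (Quotient (Perm.SameCycle.setoid D.perm)) = n}

/-- The surfaces with at most `N` squares and with labeled cylinders. -/
abbrev Labeled (W : Perm C) (n N : ℕ) : Type :=
  {x : CylinderDatum W × (C → Fin n) // Nat.card x.1.Square ≤ N ∧ IsCycleLabel x.1.perm x.2}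

/-- Square-tiled surfaces, with a choice of one of the squares at the singularity. -/
theorem exists_classes [Finite C] (hW : ∀ c, W.SameCycle c₀ c)
    (hC : Nat.card C = 2 * g - 2 + 1) :
    ∃ cls : Bounded W n N → SquareTiledSurfaces g n N, ∀ c,
      Nat.card {D // cls D = c} = Nat.card C := by
  choose T hT using fun D : CylinderDatum W =>
    (D.surface hW hC).exists_isIso (Finite.equivFin D.Square)
  let cls : Bounded W n N → SquareTiledSurfaces g n N := fun D =>
    Quotient.mk (surfaceSetoid g n N) ⟨⟨Nat.card D.1.Square, T D.1⟩, D.2.1, by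
      rw [← (hT D.1).numCylinders_eq, numCylinders_surface, D.2.2]⟩
  refine ⟨cls, fun c => ?_⟩
  obtain ⟨⟨⟨d, S⟩, hd, hS⟩, rfl⟩ := Quotient.exists_rep c
  simp only at hd hS
  have hcls : ∀ D, cls D = Quotient.mk (surfaceSetoid g n N) ⟨⟨d, S⟩, hd, hS⟩ ↔
      ∃ e, (D.1.surface hW hC).IsIso S e := by
    intro D
    constructor
    · intro h
      obtain ⟨e, he⟩ := Quotient.exact h
      exact ⟨_, (hT D.1).trans he⟩
    · rintro ⟨e, he⟩
      exact Quotient.sound ⟨_, (hT D.1).symm.trans he⟩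
  choose e he using
    fun D : {D // cls D = Quotient.mk (surfaceSetoid g n N) ⟨⟨d, S⟩, hd, hS⟩} => (hcls D.1).1 D.2
  have hcorner : ∀ D, S.bottomLeft (e D (D.1.1.corner c₀)) = S.zero := fun D =>
    ((he D).2.2 _).1 ((D.1.1.bottomLeft_surface_iff hW hC _).2 ⟨c₀, rfl⟩)
  rw [hC, ← S.card_corner]
  -- The fibre over the class of `S` is matched with the corners of `S`, by the image of `c₀` under
  -- a chosen isomorphism.
  refine Nat.card_congr (Equiv.ofBijective
    (fun D => (⟨e D (D.1.1.corner c₀), hcorner D⟩ : S.Corner)) ⟨?_, ?_⟩)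
  · intro D D' h
    refine Subtype.ext (Subtype.ext (eq_of_isIso hW hC ((he D).trans (he D').symm) ?_))
    have h1 := Subtype.mk.inj h
    rw [Equiv.trans_apply, Equiv.symm_apply_eq]
    exact h1
  · rintro ⟨r, hr⟩
    obtain ⟨D, e', he', hr'⟩ := CylinderDatum.exists_isIso hW hC S hr
    have hD : Nat.card D.Square ≤ N ∧
        Nat.card (Quotient (Perm.SameCycle.setoid D.perm)) = n := by
      refine ⟨?_, ?_⟩
      · rw [Nat.card_congr e', Nat.card_fin]
        exact hd
      · rw [← D.numCylinders_surface hW hC, he'.numCylinders_eq, hS]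
    let D' : {D // cls D = Quotient.mk (surfaceSetoid g n N) ⟨⟨d, S⟩, hd, hS⟩} :=
      ⟨⟨D, hD⟩, (hcls _).2 ⟨e', he'⟩⟩
    refine ⟨D', Subtype.ext ?_⟩
    -- The isomorphism chosen for `D'` need not be `e'` a priori; they agree because `S` has no
    -- nontrivial automorphisms.
    have h1 := S.eq_refl_of_isIso (he'.symm.trans (he D'))
    have h2 := Equiv.ext_iff.1 h1 r
    rw [Equiv.trans_apply, ← hr', symm_apply_apply] at h2
    exact h2.trans hr'

theorem card_squareTiledSurfaces [Finite C] (hW : ∀ c, W.SameCycle c₀ c)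
    (hC : Nat.card C = 2 * g - 2 + 1) [Finite (Bounded W n N)] :
    Finite (SquareTiledSurfaces g n N) ∧
      Nat.card (Bounded W n N) = Nat.card (SquareTiledSurfaces g n N) * Nat.card C := by
  obtain ⟨cls, hcls⟩ := exists_classes (n := n) (N := N) hW hC
  have hsurj : Function.Surjective cls := by
    intro c
    have h1 : Nat.card {D // cls D = c} ≠ 0 := by rw [hcls, hC]; exact Nat.succ_ne_zero _
    obtain ⟨D, hD⟩ := (Nat.card_ne_zero.1 h1).1
    exact ⟨D, hD⟩
  have hfin := Finite.of_surjective cls hsurj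
  have := Fintype.ofFinite (SquareTiledSurfaces g n N)
  refine ⟨hfin, ?_⟩
  rw [← Nat.card_congr (Equiv.sigmaFiberEquiv cls), Nat.card_sigma]
  simp [hcls]

theorem card_labels {X : Type} [Finite X] {f : Perm X}
    (hn : Nat.card (Quotient (Perm.SameCycle.setoid f)) = n) :
    Nat.card {a : X → Fin n // IsCycleLabel f a} = n.factorial := by
  have : Finite (Quotient (Perm.SameCycle.setoid f)) := Quotient.finite _
  rw [Nat.card_congr (IsCycleLabel.equivQuotient f (Fin n)),
    Nat.card_congr (Equiv.equivCongr (Finite.equivFinOfCardEq hn) (Equiv.refl (Fin n))),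
    Nat.card_perm, Nat.card_fin]

/-- Labelings of the cylinders. -/
theorem card_labeled [Finite C] [Finite (Labeled W n N)] :
    Finite (Bounded W n N) ∧
      Nat.card (Labeled W n N) = Nat.card (Bounded W n N) * n.factorial := by
  let φ : Labeled W n N → Bounded W n N := fun x => ⟨x.1.1, x.2.1, by
    rw [Nat.card_congr (IsCycleLabel.equivQuotient _ _ ⟨x.1.2, x.2.2⟩), Nat.card_fin]⟩
  have hcard : ∀ D, Nat.card {x // φ x = D} = n.factorial := by
    intro D
    rw [← card_labels D.2.2]
    refine Nat.card_congr
      { toFun := fun x => ⟨x.1.1.2, by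
          have h := x.1.2.2
          rwa [show x.1.1.1 = D.1 from congr_arg Subtype.val x.2] at h⟩
        invFun := fun a => ⟨⟨(D.1, a.1), D.2.1, a.2⟩, rfl⟩
        left_inv := ?_
        right_inv := fun _ => rfl }
    rintro ⟨x, rfl⟩
    rfl
  have hsurj : Function.Surjective φ := by
    intro D
    have h1 : Nat.card {x // φ x = D} ≠ 0 := by rw [hcard]; exact Nat.factorial_ne_zero n
    obtain ⟨x, hx⟩ := (Nat.card_ne_zero.1 h1).1
    exact ⟨x, hx⟩
  have hfin := Finite.of_surjective φ hsurj
  have := Fintype.ofFinite (Bounded W n N)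
  refine ⟨hfin, ?_⟩
  rw [← Nat.card_congr (Equiv.sigmaFiberEquiv φ), Nat.card_sigma]
  simp [hcard]

end CylinderDatum

/-! ### Heights, circumferences, metrics and twists. -/

namespace LabeledPerm

variable {C : Type} [Fintype C] {W : Perm C} {n N : ℕ}

/-- The integral metrics with given perimeters. -/
abbrev Metric (P : LabeledPerm W n n) (L : Fin n → ℕ) : Type :=
  {ℓ : C → ℕ+ // (∀ i, ∑ c with P.black c = i, (ℓ c : ℕ) = L i) ∧
    ∀ j, ∑ c with P.white c = j, (ℓ c : ℕ) = L j}

instance (P : LabeledPerm W n n) (L : Fin n → ℕ) : Finite (P.Metric L) := by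
  refine Finite.of_injective (fun (ℓ : P.Metric L) (c : C) =>
    (⟨ℓ.1 c, Nat.lt_succ_of_le ?_⟩ : Fin (L (P.black c) + 1))) fun ℓ ℓ' h => ?_
  · rw [← ℓ.2.1 (P.black c)]
    exact Finset.single_le_sum (f := fun c => (ℓ.1 c : ℕ)) (fun _ _ => Nat.zero_le _) (by simp)
  · exact Subtype.ext (funext fun c => PNat.eq (Fin.mk.inj (congr_fun h c)))

/-- The ways to glue cylinders with boundary components of equal lengths. -/
abbrev Gluing (P : LabeledPerm W n n) (ℓ : C → ℕ+) : Type :=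
  {U : Perm (Tower ℓ) // (∀ x, U (Tower.shift ℓ P.perm x) = Tower.shift ℓ (W * P.perm) (U x)) ∧
    ∀ x, P.white (U x).pt = P.black x.pt}

/-- For each label the lower and upper boundaries of the cylinder are cycles of the same length `L
i`, so `card_conj` applies; the factor `L i` counts the twists. -/
theorem card_gluing (P : LabeledPerm W n n) {L : Fin n → ℕ} (ℓ : P.Metric L) :
    Nat.card (P.Gluing ℓ.1) = ∏ i, L i := by
  have hb := Tower.isCycleLabel_shift (τ := ℓ.1) P.isCycleLabel_black
  have hw := Tower.isCycleLabel_shift (τ := ℓ.1) P.isCycleLabel_white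
  have h1 : ∀ i, Nat.card {x : Tower ℓ.1 // P.black x.pt = i} = L i := fun i => by
    rw [Tower.card_fiber, ℓ.2.1]
  have h2 : ∀ i, Nat.card {x : Tower ℓ.1 // P.white x.pt = i} = L i := fun i => by
    rw [Tower.card_fiber, ℓ.2.2]
  refine (hb.card_conj hw fun i => (h1 i).trans (h2 i).symm).trans ?_
  exact Finset.prod_congr rfl fun i _ => h2 i

/-- The decompositions of surfaces into labeled cylinders of given heights and circumferences. -/
abbrev Decomposition (W : Perm C) (n N : ℕ) : Type :=
  Σ p : {p // p ∈ heightsCircumferences n N}, Σ P : LabeledPerm W n n, Σ ℓ : P.Metric p.1.2,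
    P.Gluing ℓ.1

theorem card_decomposition [Fintype (LabeledPerm W n n)] :
    Nat.card (Decomposition W n N) = ∑ p ∈ heightsCircumferences n N,
      ∑ P : LabeledPerm W n n, P.metricCount p.2 p.2 * ∏ i, p.2 i := by
  rw [Nat.card_sigma, ← Finset.sum_coe_sort (heightsCircumferences n N)]
  refine Finset.sum_congr rfl fun p _ => ?_
  rw [Nat.card_sigma]
  refine Finset.sum_congr rfl fun P _ => ?_
  have := Fintype.ofFinite (P.Metric p.1.2)
  rw [Nat.card_sigma, Finset.sum_congr rfl fun ℓ _ => P.card_gluing ℓ, Finset.sum_const,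
    smul_eq_mul, Finset.card_univ, ← Nat.card_eq_fintype_card]
  rfl

/-- The surface with labeled cylinders given by a decomposition. -/
def Decomposition.toLabeled (x : Decomposition W n N) : CylinderDatum.Labeled W n N :=
  ⟨({ perm := x.2.1.perm
      len := x.2.2.1.1
      roof := fun y => ⟨x.1.1.1 (x.2.1.black y.pt), (mem_heightsCircumferences.1 x.1.2).1 _⟩
      gluing := x.2.2.2.1
      roof_row := fun y => by
        have h := (Tower.isCycleLabel_shift (τ := x.2.2.1.1) x.2.1.isCycleLabel_black).apply_eq y
        exact PNat.eq (congr_arg x.1.1.1 h)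
      gluing_comm := x.2.2.2.2.1 }, x.2.1.black), by
    refine (Tower.card_tower x.2.2.1.1 x.2.1.black x.1.1.1 _ fun _ => rfl).trans_le ?_
    simp only [x.2.2.1.2.1]
    exact (mem_heightsCircumferences.1 x.1.2).2.2, x.2.1.isCycleLabel_black⟩

theorem Decomposition.toLabeled_injective :
    Function.Injective (Decomposition.toLabeled : Decomposition W n N → _) := by
  rintro ⟨⟨⟨h, L⟩, hp⟩, ⟨perm, black, white, hb, hw⟩, ⟨ℓ, hℓ, hℓ'⟩, ⟨U, hU, hU'⟩⟩
    ⟨⟨⟨h', L'⟩, hp'⟩, ⟨perm', black', white', hb', hw'⟩, ⟨ℓ', hℓ₁, hℓ₁'⟩, ⟨U', hU₁, hU₁'⟩⟩ hx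
  obtain ⟨hx, hx'⟩ := Prod.mk.inj (Subtype.mk.inj hx)
  obtain ⟨h1, h2, hroof, hU⟩ := CylinderDatum.mk.inj hx
  simp only at h1 h2 hx' hroof hU
  subst h1 h2 hx'
  obtain rfl := eq_of_heq hU
  have hroof := eq_of_heq hroof
  simp only at hℓ hℓ₁ hU' hU₁'
  obtain rfl : L = L' := funext fun i => (hℓ i).symm.trans (hℓ₁ i)
  obtain rfl : h = h' := funext fun i => by
    obtain ⟨c, rfl⟩ := hb.1 i
    exact congr_arg PNat.val (congr_fun hroof (Tower.base ℓ c))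
  -- The white labels are recovered from the gluing, which carries the label of each cylinder from
  -- its lower to its upper boundary.
  obtain rfl : white = white' := funext fun c => by
    have h1 := hU' (U.symm (Tower.base ℓ c))
    have h2 := hU₁' (U.symm (Tower.base ℓ c))
    rw [apply_symm_apply] at h1 h2
    exact h1.trans h2.symm
  rfl

theorem Decomposition.toLabeled_surjective :
    Function.Surjective (Decomposition.toLabeled : Decomposition W n N → _) := by
  rintro ⟨⟨⟨perm, len, roof, U, hrow, hU⟩, a⟩, hN, ha⟩
  simp only at hN ha
  have hR := Tower.isCycleLabel_shift (τ := len) ha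
  choose c hc using ha.1
  let h : Fin n → ℕ := fun i => roof (Tower.base len (c i))
  have hroof : ∀ x, (roof x : ℕ) = h (a x.pt) := fun x => by
    have h1 := (hR.2 (Tower.base len (c (a x.pt))) x).1 (hc _)
    have h2 := (h1.iff_of_closed (P := fun y => roof y = roof (Tower.base len (c (a x.pt))))
      fun y hy => (hrow y).trans hy).1 rfl
    rw [h2]
  -- Transporting the cylinder labels by `U` labels the cycles of the shift by `W * perm`; this is
  -- the only possible choice of `white`.
  have hM := hR.comp_symm hU
  let white : C → Fin n := fun c => a (U.symm (Tower.base len c)).pt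
  have hwhite : ∀ y : Tower len, white y.pt = a (U.symm y).pt := fun y =>
    (hM.2 _ _).2 ((Tower.sameCycle_shift_iff _ _ _).2 (Perm.SameCycle.refl _ _))
  let P : LabeledPerm W n n :=
    { perm := perm
      black := a
      white := white
      isCycleLabel_black := ha
      isCycleLabel_white := by
        refine ⟨fun i => ?_, fun d d' => ?_⟩
        · obtain ⟨y, hy⟩ := hM.1 i
          exact ⟨y.pt, (hwhite y).trans hy⟩
        · exact (hM.2 (Tower.base len d) (Tower.base len d')).trans
            (Tower.sameCycle_shift_iff _ _ _) }
  let L : Fin n → ℕ := fun i => ∑ d with a d = i, (len d : ℕ)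
  -- `U` maps the bottom row of the cylinder `i` bijectively to its upper boundary, so the white
  -- perimeters equal the black ones.
  have hL : ∀ i, ∑ d with white d = i, (len d : ℕ) = L i := fun i => by
    simp only [L]
    rw [← Tower.card_fiber, ← Tower.card_fiber]
    exact Nat.card_congr (Equiv.subtypeEquiv U.symm fun y => by rw [hwhite])
  have hp : (h, L) ∈ heightsCircumferences n N := by
    refine mem_heightsCircumferences.2 ⟨fun i => PNat.pos _, fun i => ?_, ?_⟩
    · exact Finset.sum_pos (fun d _ => PNat.pos _) ⟨c i, by simp [hc]⟩
    · exact (Tower.card_tower len a h roof hroof).symm.trans_le hN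
  refine ⟨⟨⟨(h, L), hp⟩, P, ⟨len, fun _ => rfl, hL⟩, U, hU, fun x => ?_⟩, ?_⟩
  · exact (hwhite (U x)).trans (by rw [symm_apply_apply])
  · exact Subtype.ext (Prod.ext (CylinderDatum.ext rfl rfl
      (heq_of_eq (funext fun y => PNat.eq (hroof y).symm)) HEq.rfl) rfl)

/-- The number of surfaces with a chosen square at the singularity and with labeled cylinders. -/
theorem card_labeled [Fintype (LabeledPerm W n n)] : Finite (CylinderDatum.Labeled W n N) ∧
    Nat.card (CylinderDatum.Labeled W n N) = ∑ p ∈ heightsCircumferences n N,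
      ∑ P : LabeledPerm W n n, P.metricCount p.2 p.2 * ∏ i, p.2 i := by
  have e : Decomposition W n N ≃ CylinderDatum.Labeled W n N := Equiv.ofBijective
    Decomposition.toLabeled ⟨Decomposition.toLabeled_injective, Decomposition.toLabeled_surjective⟩
  exact ⟨Finite.of_equiv _ e, by rw [← Nat.card_congr e, card_decomposition]⟩

end LabeledPerm

theorem proposition1 (g n N : ℕ) (hn : 1 ≤ n) (hng : n ≤ g) :
    Finite (SquareTiledSurfaces g n N) ∧
    (Nat.card (SquareTiledSurfaces g n N) : ℚ) =
      1 / (Nat.factorial n : ℚ) *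
        ∑ p ∈ heightsCircumferences n N,
          (∏ i, (p.2 i : ℚ)) *
            weightedCount (g - n) n n (fun i => (p.2 i : ℤ)) (fun i => (p.2 i : ℤ)) := by
  -- A model for the horizontal directions at the singularity, in cyclic order.
  let C := ZMod (2 * g - 2 + 1)
  let W : Perm C := Equiv.addRight 1
  have hW : ∀ c, W.SameCycle 0 c := fun c => ⟨c.val, by
    have h : (W ^ (c.val : ℤ)) 0 = ZMod.cast c := by simp [W]
    rw [h, ZMod.cast_id]⟩
  have hC : Nat.card C = 2 * g - 2 + 1 := by
    rw [Nat.card_eq_fintype_card, ZMod.card]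
  -- The number of saddle connections equals the number of edges: `2n - 1 + 2(g - n) = 2g - 1`. Here
  -- `1 ≤ n ≤ g` keeps the natural subtractions from truncating.
  have hC' : (Nat.card C : ℤ) = n + n - 1 + 2 * (g - n : ℕ) := by
    rw [hC]
    omega
  have := Fintype.ofFinite (LabeledPerm W n n)
  obtain ⟨h1, h2⟩ := LabeledPerm.card_labeled (W := W) (n := n) (N := N)
  obtain ⟨h3, h4⟩ := CylinderDatum.card_labeled (W := W) (n := n) (N := N)
  obtain ⟨h5, h6⟩ := CylinderDatum.card_squareTiledSurfaces (n := n) (N := N) hW hC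
  refine ⟨h5, ?_⟩
  have hC0 : (Nat.card C : ℚ) ≠ 0 := by
    rw [hC]
    positivity
  have hn0 : (n.factorial : ℚ) ≠ 0 := by positivity
  -- Both sides count rooted surfaces with labeled cylinders.
  have key : (Nat.card (SquareTiledSurfaces g n N) : ℚ) * Nat.card C * n.factorial =
      Nat.card C * ∑ p ∈ heightsCircumferences n N, (∏ i, (p.2 i : ℚ)) *
        weightedCount (g - n) n n (fun i => (p.2 i : ℤ)) (fun i => (p.2 i : ℤ)) := by
    rw [← Nat.cast_mul, ← h6, ← Nat.cast_mul, ← h4, h2, Finset.mul_sum]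
    push_cast
    refine Finset.sum_congr rfl fun p _ => ?_
    rw [← Finset.sum_mul, ← LabeledPerm.card_mul_weightedCount hW hC' p.2 p.2]
    ring
  rw [one_div, eq_inv_mul_iff_mul_eq₀ hn0]
  apply mul_left_cancel₀ hC0
  rw [← key]
  ring
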